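/- **Setting.** All systems are finite-dimensional with a fixed orthonormal (incoherent) basis; composite systems carry the product basis. A state is incoherent if its density matrix is diagonal in this basis; the set of incoherent states is $\mathcal I$. An incoherent operation $\Phi$ (possibly between different systems) is a map $\Phi(\rho)=\sum_n K_n\rho K_n^\dagger$ with finitely many Kraus operators satisfying $\sum_n K_n^\dagger K_n=\mathbb 1$ and such that each $K_n$ maps diagonal density matrices to diagonal matrices (such $\{K_n\}$ are called incoherent Kraus operators). For a state $\rho$ with eigenvalues $\lambda_i$ and orthonormal eigenvectors $|i\rangle$, and a Hermitian $H$, the quantum Fisher information is $$\mathcal F(\rho,H)=2\sum_{i,j:\ \lambda_i+\lambda_j\neq 0}\frac{(\lambda_i-\lambda_j)^2}{\lambda_i+\lambda_j}\,|\langle i|H|j\rangle|^2 .$$ Let $M,N\ge 1$. For $1\le k\le M$, $1\le j\le N$ let $h^{(k,j)}$ be a Hermitian operator on a finite-dimensional particle space that is not a multiple of the identity; the incoherent basis of that particle is a chosen orthonormal eigenbasis of $h^{(k,j)}$. Put $H_S^{(k)}=\sum_{j=1}^N h^{(k,j)}$, where $h^{(k,j)}$ acts on the $j$th particle of the $k$th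 partition. For a pure state $|\psi\rangle$ of any finite-dimensional system define $$\mathcal C_F^M(|\psi\rangle)=\sup_{\Phi}\ \sum_{k=1}^M \mathcal F\big(\mathrm{Tr}_{P(k)^c}[\Phi(|\psi\rangle\langle\psi|)],\,H_S^{(k)}\big),$$ where $\Phi$ ranges over all incoherent operations whose output system consists of $M$ partitions $P(1),\dots,P(M)$, the partition $P(k)$ consisting of the $N$ particles on which $H_S^{(k)}$ acts and of an arbitrary finite-dimensional ancilla on which it acts trivially, and $\mathrm{Tr}_{P(k)^c}$ traces out all partitions except $P(k)$. For an arbitrary state $\rho$ define the convex roof $$\mathcal C_F^M(\rho)=\inf\ \sum_i p_i\,\mathcal C_F^M(|\psi_i\rangle)$$ over all finite pure state decompositions $\rho=\sum_i p_i|\psi_i\rangle\langle\psi_i|$. **Theorem.** For all $M,N\ge 1$ and all $h^{(k,j)}$ as above, the supremum and the infimum are over non-empty sets of real numbers that are bounded above and below, respectively, so that $\mathcal C_F^M$ is a well-defined real-valued function, and $\mathcal C_F^M$ is a coherence measure: 1. (Faithfulness) $\mathcal C_F^M(\rho)\ge 0$ for every state $\rho$, with equality if and only if $\rho\in\mathcal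 I$. 2. (Monotonicity) $\mathcal C_F^M(\Phi(\rho))\le \mathcal C_F^M(\rho)$ for every state $\rho$ and every incoherent operation $\Phi$. 3. (Strong monotonicity) For every state $\rho$ and all incoherent Kraus operators $\{K_n\}$, $\sum_{n:\,p_n>0} p_n\,\mathcal C_F^M(\rho_n)\le \mathcal C_F^M(\rho)$, where $p_n=\mathrm{Tr}[K_n\rho K_n^\dagger]$ and $\rho_n=K_n\rho K_n^\dagger/p_n$. 4. (Convexity) $\mathcal C_F^M(\lambda\rho+(1-\lambda)\sigma)\le\lambda\,\mathcal C_F^M(\rho)+(1-\lambda)\,\mathcal C_F^M(\sigma)$ for all states $\rho,\sigma$ of the same system and $0\le\lambda\le 1$. -/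

import Mathlib

open scoped Matrix Kronecker ComplexOrder

noncomputable section

namespace CoherenceQFI

/-! Finite-dimensional systems are given by a finite index set `ι` labelling the fixed incoherent
orthonormal basis; operators are matrices in that basis. -/

/-- Density matrices: positive semidefinite with unit trace. -/
def IsDensity {ι : Type} [Fintype ι] (ρ : Matrix ι ι ℂ) : Prop :=
  ρ.PosSemidef ∧ ρ.trace = 1

/-- Incoherent states: density matrices that are diagonal in the fixed basis. -/
def IsIncoherentState {ι : Type} [Fintype ι] (ρ : Matrix ι ι ℂ) : Prop :=
  IsDensity ρ ∧ ρ.IsDiag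

/-- A normalized state vector. -/
def IsUnitVector {ι : Type} [Fintype ι] (ψ : ι → ℂ) : Prop :=
  ∑ i, ‖ψ i‖ ^ 2 = 1

/-- The rank-one projector `|ψ⟩⟨ψ|`. -/
def pureState {ι : Type} (ψ : ι → ℂ) : Matrix ι ι ℂ :=
  Matrix.vecMulVec ψ (star ψ)

/-- A complete set of incoherent Kraus operators: `∑ₙ Kₙ† Kₙ = 1`, and each `Kₙ` maps every
incoherent state to an (unnormalized) incoherent state. -/
def IsIncoherentKraus {ι κ : Type} [Fintype ι] [DecidableEq ι] [Fintype κ] {r : ℕ}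
    (K : Fin r → Matrix κ ι ℂ) : Prop :=
  ∑ n, (K n)ᴴ * K n = 1 ∧
    ∀ n, ∀ σ : Matrix ι ι ℂ, IsIncoherentState σ → (K n * σ * (K n)ᴴ).IsDiag

/-- Incoherent completely positive trace preserving maps (from a system with basis `ι` to a system
with basis `κ`): the maps `ρ ↦ ∑ₙ Kₙ ρ Kₙ†` with incoherent Kraus operators `Kₙ`. -/
def IsIncoherentOperation {ι κ : Type} [Fintype ι] [DecidableEq ι] [Fintype κ]
    (Φ : Matrix ι ι ℂ →ₗ[ℂ] Matrix κ κ ℂ) : Prop :=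
  ∃ (r : ℕ) (K : Fin r → Matrix κ ι ℂ), IsIncoherentKraus K ∧
    ∀ ρ, Φ ρ = ∑ n, K n * ρ * (K n)ᴴ

/-- The axioms of a coherence measure `C`, a real-valued function of the
states of every finite-dimensional system. -/
structure IsCoherenceMeasure
    (C : ∀ (ι : Type) [Fintype ι] [DecidableEq ι], Matrix ι ι ℂ → ℝ) : Prop where
  /-- Nonnegativity. -/
  nonneg : ∀ (ι : Type) [Fintype ι] [DecidableEq ι] (ρ : Matrix ι ι ℂ),
    IsDensity ρ → 0 ≤ C ι ρ
  /-- Faithfulness. -/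
  faithful : ∀ (ι : Type) [Fintype ι] [DecidableEq ι] (ρ : Matrix ι ι ℂ),
    IsDensity ρ → (C ι ρ = 0 ↔ IsIncoherentState ρ)
  /-- Monotonicity under incoherent operations. -/
  monotone : ∀ (ι κ : Type) [Fintype ι] [DecidableEq ι] [Fintype κ] [DecidableEq κ]
    (Φ : Matrix ι ι ℂ →ₗ[ℂ] Matrix κ κ ℂ) (ρ : Matrix ι ι ℂ),
    IsIncoherentOperation Φ → IsDensity ρ → C κ (Φ ρ) ≤ C ι ρ
  /-- Strong monotonicity: `∑ₙ pₙ C(ρₙ) ≤ C(ρ)` with `pₙ = Tr[Kₙ ρ Kₙ†]` and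
  `ρₙ = Kₙ ρ Kₙ† / pₙ`; outcomes with `pₙ = 0` contribute `0`. -/
  strongMonotone : ∀ (ι κ : Type) [Fintype ι] [DecidableEq ι] [Fintype κ] [DecidableEq κ]
    (r : ℕ) (K : Fin r → Matrix κ ι ℂ) (ρ : Matrix ι ι ℂ),
    IsIncoherentKraus K → IsDensity ρ →
      ∑ n, (K n * ρ * (K n)ᴴ).trace.re *
        C κ (((K n * ρ * (K n)ᴴ).trace.re)⁻¹ • (K n * ρ * (K n)ᴴ)) ≤ C ι ρ
  /-- Convexity. -/
  convex : ∀ (ι : Type) [Fintype ι] [DecidableEq ι] (ρ σ : Matrix ι ι ℂ) (t : ℝ),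
    IsDensity ρ → IsDensity σ → 0 ≤ t → t ≤ 1 →
      C ι (t • ρ + (1 - t) • σ) ≤ t * C ι ρ + (1 - t) * C ι σ

open Classical in
/-- Quantum Fisher information
`F(ρ, H) = 2 ∑_{i,j} (λᵢ - λⱼ)² / (λᵢ + λⱼ) |⟨i|H|j⟩|²`, where `λᵢ`, `|i⟩` are the eigenvalues and an
orthonormal eigenbasis of `ρ`. Terms with `λᵢ + λⱼ = 0` are omitted (they are `0` by `x / 0 = 0`).
The value at a non-Hermitian `ρ` is irrelevant. -/
def qfi {ι : Type} [Fintype ι] [DecidableEq ι] (ρ H : Matrix ι ι ℂ) : ℝ :=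
  if hρ : ρ.IsHermitian then
    2 * ∑ i, ∑ j, (hρ.eigenvalues i - hρ.eigenvalues j) ^ 2 /
      (hρ.eigenvalues i + hρ.eigenvalues j) *
        ‖inner ℂ (hρ.eigenvectorBasis i) (Matrix.toEuclideanLin H (hρ.eigenvectorBasis j))‖ ^ 2
  else 0

/-- Basis labels of the `N` particles, of dimensions `d 0, …, d (N - 1)`, probed in one
partition. -/
abbrev Particles {N : ℕ} (d : Fin N → ℕ) : Type := ∀ j : Fin N, Fin (d j)

/-- Basis labels of one partition: `N` particles that interact with the Hamiltonian, and ancillary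
particles of total dimension `a` that do not. -/
abbrev Partition {N : ℕ} (d : Fin N → ℕ) (a : ℕ) : Type := Particles d × Fin a

/-- Basis labels of the whole output system, consisting of `M` partitions. -/
abbrev Output {M N : ℕ} (d : Fin M → Fin N → ℕ) (a : Fin M → ℕ) : Type :=
  ∀ k : Fin M, Partition (d k) (a k)

/-- The operator acting as `h` on particle `j` and as the identity on all other particles. -/
def onParticle {N : ℕ} {d : Fin N → ℕ} (j : Fin N) (h : Matrix (Fin (d j)) (Fin (d j)) ℂ) :
    Matrix (Particles d) (Particles d) ℂ :=
  Matrix.of fun x y => if ∀ l, l ≠ j → x l = y l then h (x j) (y j) else 0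

/-- The local Hamiltonian `∑ⱼ h⁽ʲ⁾` on a partition; it acts trivially on the ancillas. -/
def localHamiltonian {N : ℕ} {d : Fin N → ℕ} (h : ∀ j, Matrix (Fin (d j)) (Fin (d j)) ℂ)
    (a : ℕ) : Matrix (Partition d a) (Partition d a) ℂ :=
  (∑ j, onParticle j (h j)) ⊗ₖ (1 : Matrix (Fin a) (Fin a) ℂ)

/-- Partial trace over all partitions except the `k`-th:
`⟨x| Tr_{P(k)ᶜ} ρ |y⟩ = ∑_z ⟨x, z| ρ |y, z⟩`, the sum over the labels `z` of the other partitions.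
The label `f` below runs over the pairs `(x, z)`. -/
def reduceTo {M : ℕ} {P : Fin M → Type} [∀ k, Fintype (P k)] [∀ k, DecidableEq (P k)]
    (k : Fin M) (ρ : Matrix (∀ l, P l) (∀ l, P l) ℂ) : Matrix (P k) (P k) ℂ :=
  Matrix.of fun x y => ∑ f : (∀ l, P l), if f k = x then ρ f (Function.update f k y) else 0

/-- All values `∑ₖ F(Tr_{P(k)ᶜ} Φ(|ψ⟩⟨ψ|), H⁽ᵏ⁾)`, over all incoherent operations `Φ` whose output
consists of `M` partitions, each with any number of ancillary levels besides the `N` particles. -/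
def pureValues {M N : ℕ} {d : Fin M → Fin N → ℕ}
    (h : ∀ k j, Matrix (Fin (d k j)) (Fin (d k j)) ℂ)
    {ι : Type} [Fintype ι] [DecidableEq ι] (ψ : ι → ℂ) : Set ℝ :=
  {v | ∃ (a : Fin M → ℕ) (Φ : Matrix ι ι ℂ →ₗ[ℂ] Matrix (Output d a) (Output d a) ℂ),
    IsIncoherentOperation Φ ∧
      v = ∑ k, qfi (reduceTo k (Φ (pureState ψ))) (localHamiltonian (h k) (a k))}

/-- The distributed QFI coherence of a pure state. -/
def pureCoherence {M N : ℕ} {d : Fin M → Fin N → ℕ}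
    (h : ∀ k j, Matrix (Fin (d k j)) (Fin (d k j)) ℂ)
    {ι : Type} [Fintype ι] [DecidableEq ι] (ψ : ι → ℂ) : ℝ :=
  sSup (pureValues h ψ)

/-- All average values `∑ᵢ pᵢ C(|ψᵢ⟩)` over pure state decompositions `ρ = ∑ᵢ pᵢ |ψᵢ⟩⟨ψᵢ|`. -/
def roofValues {M N : ℕ} {d : Fin M → Fin N → ℕ}
    (h : ∀ k j, Matrix (Fin (d k j)) (Fin (d k j)) ℂ)
    {ι : Type} [Fintype ι] [DecidableEq ι] (ρ : Matrix ι ι ℂ) : Set ℝ :=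
  {v | ∃ (m : ℕ) (p : Fin m → ℝ) (ψ : Fin m → ι → ℂ),
    (∀ i, 0 ≤ p i) ∧ ∑ i, p i = 1 ∧ (∀ i, IsUnitVector (ψ i)) ∧
      ρ = ∑ i, p i • pureState (ψ i) ∧ v = ∑ i, p i * pureCoherence h (ψ i)}

/-- The distributed QFI coherence of a general state: the convex roof of `pureCoherence`. -/
def distributedQFICoherence {M N : ℕ} {d : Fin M → Fin N → ℕ}
    (h : ∀ k j, Matrix (Fin (d k j)) (Fin (d k j)) ℂ)
    (ι : Type) [Fintype ι] [DecidableEq ι] (ρ : Matrix ι ι ℂ) : ℝ :=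
  sInf (roofValues h ρ)

end CoherenceQFI

end

/-! For positive semidefinite `ρ` the quantum Fisher information `qfi ρ H` is the maximum over all
matrices `X` of `2 Re Tr[ρ (H Xᴴ - Xᴴ H)] - Re Tr[ρ (X Xᴴ + Xᴴ X)] / 2`, as completing the square in
an eigenbasis of `ρ` shows. This functional is linear in `ρ`, so `qfi` is convex in `ρ` and
superadditive over orthogonal subspaces that reduce `H`; moreover `qfi ρ H = 0` if and only if `ρ`
commutes with `H`.

Pure states satisfy strong monotonicity because the outcome of an incoherent measurement may be
recorded in the ancilla of every partition: running a near-optimal operation after each outcome then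
gives a single incoherent operation whose branches are orthogonal. The convex roof inherits strong
monotonicity, and monotonicity follows from it by convexity. An incoherent pure state only has
diagonal outputs, which commute with the diagonal Hamiltonians. Conversely, two basis states of the
input can be encoded into particle configurations of different energy, so an output that commutes
with the Hamiltonian forces the corresponding entry of the density matrix to vanish. -/

namespace CoherenceQFI

section Isometry

variable {ι κ : Type*} [Fintype ι] [Fintype κ]

/-- The matrix `E` intertwines `A` and `B`, and `Eᴴ` intertwines `B` and `A`: for an isometry `E`,
its range reduces `A`, and `A` acts on it as `B`. -/
structure Intertwines (E : Matrix ι κ ℂ) (A : Matrix ι ι ℂ) (B : Matrix κ κ ℂ) : Prop where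
  mul_eq : A * E = E * B
  conjTranspose_mul_eq : Eᴴ * A = B * Eᴴ

namespace Intertwines

variable {E : Matrix ι κ ℂ} {A A' : Matrix ι ι ℂ} {B B' : Matrix κ κ ℂ}

lemma conjTranspose (h : Intertwines E A B) : Intertwines E Aᴴ Bᴴ where
  mul_eq := by
    simpa only [Matrix.conjTranspose_mul, Matrix.conjTranspose_conjTranspose] using
      congrArg Matrix.conjTranspose h.conjTranspose_mul_eq
  conjTranspose_mul_eq := by
    simpa only [Matrix.conjTranspose_mul] using congrArg Matrix.conjTranspose h.mul_eq

lemma mul (h : Intertwines E A B) (h' : Intertwines E A' B') :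
    Intertwines E (A * A') (B * B') where
  mul_eq := by rw [Matrix.mul_assoc, h'.mul_eq, ← Matrix.mul_assoc, h.mul_eq, Matrix.mul_assoc]
  conjTranspose_mul_eq := by
    rw [← Matrix.mul_assoc, h.conjTranspose_mul_eq, Matrix.mul_assoc, h'.conjTranspose_mul_eq,
      Matrix.mul_assoc]

lemma add (h : Intertwines E A B) (h' : Intertwines E A' B') :
    Intertwines E (A + A') (B + B') where
  mul_eq := by rw [Matrix.add_mul, Matrix.mul_add, h.mul_eq, h'.mul_eq]
  conjTranspose_mul_eq := by
    rw [Matrix.add_mul, Matrix.mul_add, h.conjTranspose_mul_eq, h'.conjTranspose_mul_eq]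

lemma sub (h : Intertwines E A B) (h' : Intertwines E A' B') :
    Intertwines E (A - A') (B - B') where
  mul_eq := by rw [Matrix.sub_mul, Matrix.mul_sub, h.mul_eq, h'.mul_eq]
  conjTranspose_mul_eq := by
    rw [Matrix.sub_mul, Matrix.mul_sub, h.conjTranspose_mul_eq, h'.conjTranspose_mul_eq]

lemma trace_conj_mul [DecidableEq κ] (h : Intertwines E A B) (hE : Eᴴ * E = 1)
    (τ : Matrix κ κ ℂ) : (E * τ * Eᴴ * A).trace = (τ * B).trace := by
  rw [Matrix.mul_assoc _ Eᴴ, h.conjTranspose_mul_eq, Matrix.trace_mul_comm, ← Matrix.mul_assoc,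
    Matrix.mul_assoc B, hE, Matrix.mul_one, Matrix.trace_mul_comm]

end Intertwines

lemma intertwines_sum_conj {α : Type*} [Fintype α] {β : α → Type*} [∀ n, Fintype (β n)]
    [∀ n, DecidableEq (β n)] {E : ∀ n, Matrix ι (β n) ℂ} (hE : ∀ n, (E n)ᴴ * E n = 1)
    (hE' : Pairwise fun m n => (E m)ᴴ * E n = 0) (X : ∀ n, Matrix (β n) (β n) ℂ) (n : α) :
    Intertwines (E n) (∑ m, E m * X m * (E m)ᴴ) (X n) where
  mul_eq := by
    rw [Matrix.sum_mul, Fintype.sum_eq_single n fun m hm => by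
        rw [Matrix.mul_assoc, hE' hm, Matrix.mul_zero],
      Matrix.mul_assoc, hE, Matrix.mul_one]
  conjTranspose_mul_eq := by
    rw [Matrix.mul_sum, Fintype.sum_eq_single n fun m hm => by
        rw [Matrix.mul_assoc, ← Matrix.mul_assoc, hE' hm.symm, Matrix.zero_mul],
      ← Matrix.mul_assoc, ← Matrix.mul_assoc, hE, Matrix.one_mul]

end Isometry

section FisherFunctional

variable {ι κ : Type*} [Fintype ι] [Fintype κ]

/-- The concave functional `X ↦ 2 Re Tr[Xᴴ (ρ H - H ρ)] - Re Tr[ρ (X Xᴴ + Xᴴ X)] / 2`, whose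
maximum is the quantum Fisher information. Both traces are arranged so that `ρ` comes first, which
makes the linearity in `ρ` visible. -/
noncomputable def fisherFunctional (ρ H X : Matrix ι ι ℂ) : ℝ :=
  2 * (ρ * (H * Xᴴ - Xᴴ * H)).trace.re - 1 / 2 * (ρ * (X * Xᴴ + Xᴴ * X)).trace.re

lemma fisherFunctional_sum {α : Type*} (s : Finset α) (ρ : α → Matrix ι ι ℂ)
    (H X : Matrix ι ι ℂ) :
    fisherFunctional (∑ n ∈ s, ρ n) H X = ∑ n ∈ s, fisherFunctional (ρ n) H X := by
  simp only [fisherFunctional, Matrix.sum_mul, Matrix.trace_sum, Complex.re_sum, Finset.mul_sum,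
    Finset.sum_sub_distrib]

lemma fisherFunctional_smul (c : ℝ) (ρ H X : Matrix ι ι ℂ) :
    fisherFunctional (c • ρ) H X = c * fisherFunctional ρ H X := by
  simp only [fisherFunctional, Matrix.smul_mul, Matrix.trace_smul, Complex.smul_re, smul_eq_mul]
  ring

lemma fisherFunctional_conj [DecidableEq κ] {E : Matrix ι κ ℂ} (hE : Eᴴ * E = 1)
    {H X : Matrix ι ι ℂ} {G Y : Matrix κ κ ℂ} (hH : Intertwines E H G) (hX : Intertwines E X Y)
    (τ : Matrix κ κ ℂ) : fisherFunctional (E * τ * Eᴴ) H X = fisherFunctional τ G Y := by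
  rw [fisherFunctional, fisherFunctional,
    ((hH.mul hX.conjTranspose).sub (hX.conjTranspose.mul hH)).trace_conj_mul hE,
    ((hX.mul hX.conjTranspose).add (hX.conjTranspose.mul hX)).trace_conj_mul hE]

lemma re_trace_diagonal_mul [DecidableEq ι] (l : ι → ℝ) (A : Matrix ι ι ℂ) :
    (Matrix.diagonal (fun i => (l i : ℂ)) * A).trace.re = ∑ i, l i * (A i i).re := by
  simp only [Matrix.trace, Matrix.diag_apply, Matrix.diagonal_mul, Complex.re_sum,
    Complex.re_ofReal_mul]

lemma fisherFunctional_diagonal [DecidableEq ι] (l : ι → ℝ) (G Y : Matrix ι ι ℂ) :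
    fisherFunctional (Matrix.diagonal fun i => (l i : ℂ)) G Y =
      ∑ i, ∑ j, (2 * (l i - l j) * (G i j * star (Y i j)).re -
        1 / 2 * (l i + l j) * ‖Y i j‖ ^ 2) := by
  have hGY : ∀ i, ((G * Yᴴ - Yᴴ * G) i i).re =
      ∑ j, (G i j * star (Y i j)).re - ∑ j, (G j i * star (Y j i)).re := fun i => by
    simp only [Matrix.sub_apply, Complex.sub_re, Matrix.mul_apply, Matrix.conjTranspose_apply,
      Complex.re_sum, mul_comm]
  have hYY : ∀ i, ((Y * Yᴴ + Yᴴ * Y) i i).re = ∑ j, ‖Y i j‖ ^ 2 + ∑ j, ‖Y j i‖ ^ 2 := fun i => by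
    simp only [Matrix.add_apply, Complex.add_re, Matrix.mul_apply, Matrix.conjTranspose_apply,
      Complex.re_sum, Complex.star_def, Complex.mul_conj', Complex.conj_mul', ← Complex.ofReal_pow,
      Complex.ofReal_re]
  have hcomm : ∑ i, l i * ∑ j, (G j i * star (Y j i)).re =
      ∑ i, ∑ j, l j * (G i j * star (Y i j)).re := by
    simp only [Finset.mul_sum]
    exact Finset.sum_comm
  have hanti : ∑ i, l i * ∑ j, ‖Y j i‖ ^ 2 = ∑ i, ∑ j, l j * ‖Y i j‖ ^ 2 := by
    simp only [Finset.mul_sum]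
    exact Finset.sum_comm
  simp only [fisherFunctional, re_trace_diagonal_mul, hGY, hYY]
  simp only [mul_sub, mul_add, Finset.sum_sub_distrib, Finset.sum_add_distrib, hcomm, hanti]
  simp only [sub_mul, add_mul, Finset.sum_sub_distrib, Finset.sum_add_distrib, Finset.mul_sum,
    mul_assoc]

lemma fisherFunctional_eq_sub {ρ : Matrix ι ι ℂ} (hρ : ρ.IsHermitian) (H X : Matrix ι ι ℂ) :
    fisherFunctional ρ H X = 2 * (ρ * (H * Hᴴ + Hᴴ * H)).trace.re -
      1 / 2 * ((ρ * ((X - (2 : ℝ) • H) * (X - (2 : ℝ) • H)ᴴ)).trace.re +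
        (ρ * ((X + (2 : ℝ) • H)ᴴ * (X + (2 : ℝ) • H))).trace.re) := by
  have hre : ∀ A, (ρ * Aᴴ).trace.re = (ρ * A).trace.re := fun A => by
    rw [← Complex.conj_re, starRingEnd_apply, ← Matrix.trace_conjTranspose,
      Matrix.conjTranspose_mul, Matrix.conjTranspose_conjTranspose, hρ.eq, Matrix.trace_mul_comm]
  have h1 := hre (X * Hᴴ)
  have h2 := hre (Hᴴ * X)
  rw [Matrix.conjTranspose_mul, Matrix.conjTranspose_conjTranspose] at h1 h2
  simp only [fisherFunctional, Matrix.conjTranspose_add, Matrix.conjTranspose_sub,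
    Matrix.conjTranspose_smul, star_trivial, Matrix.mul_add, Matrix.mul_sub, Matrix.add_mul,
    Matrix.sub_mul, Matrix.smul_mul, Matrix.mul_smul, Matrix.trace_add, Matrix.trace_sub,
    Matrix.trace_smul, Complex.add_re, Complex.sub_re, Complex.smul_re, smul_eq_mul, h1, h2]
  ring

end FisherFunctional

section FisherInformation

lemma re_mul_star_eq_sub_sq {l m : ℝ} (hl : 0 ≤ l) (hm : 0 ≤ m) (g y : ℂ) :
    2 * (l - m) * (g * star y).re - 1 / 2 * (l + m) * ‖y‖ ^ 2 =
      2 * ((l - m) ^ 2 / (l + m) * ‖g‖ ^ 2) -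
        1 / 2 * (l + m) * ‖y - ((2 * (l - m) / (l + m) : ℝ) : ℂ) * g‖ ^ 2 := by
  rcases (add_nonneg hl hm).eq_or_lt with h | h
  · obtain rfl : l = 0 := by linarith
    obtain rfl : m = 0 := by linarith
    simp
  · simp only [← Complex.normSq_eq_norm_sq, Complex.normSq_apply, Complex.sub_re, Complex.sub_im,
      Complex.ofReal_re, Complex.ofReal_im, Complex.mul_re, Complex.mul_im, Complex.star_def,
      Complex.conj_re, Complex.conj_im]
    field_simp
    ring

/-- Conjugation of operators into the eigenbasis of `ρ`, in which `ρ` is diagonal. -/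
noncomputable def inEigenbasis {ι : Type*} [Fintype ι] [DecidableEq ι] {ρ : Matrix ι ι ℂ}
    (hρ : ρ.IsHermitian) : Matrix ι ι ℂ ≃⋆ₐ[ℂ] Matrix ι ι ℂ :=
  Unitary.conjStarAlgAut ℂ _ (star hρ.eigenvectorUnitary)

lemma inEigenbasis_self {ι : Type*} [Fintype ι] [DecidableEq ι] {ρ : Matrix ι ι ℂ}
    (hρ : ρ.IsHermitian) :
    inEigenbasis hρ ρ = Matrix.diagonal fun i => (hρ.eigenvalues i : ℂ) :=
  hρ.conjStarAlgAut_star_eigenvectorUnitary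

lemma fisherFunctional_inEigenbasis {ι : Type*} [Fintype ι] [DecidableEq ι] {ρ : Matrix ι ι ℂ}
    (hρ : ρ.IsHermitian) (σ H X : Matrix ι ι ℂ) :
    fisherFunctional (inEigenbasis hρ σ) (inEigenbasis hρ H) (inEigenbasis hρ X) =
      fisherFunctional σ H X := by
  have htrace : ∀ A, (inEigenbasis hρ A).trace = A.trace := fun A => by
    rw [inEigenbasis, Unitary.conjStarAlgAut_star_apply, Matrix.trace_mul_cycle,
      ← Unitary.coe_star, Unitary.coe_mul_star_self, one_mul]
  simp only [fisherFunctional, ← Matrix.star_eq_conjTranspose, ← map_star, ← map_mul, ← map_sub,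
    ← map_add, htrace]

variable {ι : Type} [Fintype ι] [DecidableEq ι] {ρ : Matrix ι ι ℂ}

lemma inner_eigenvectorBasis (hρ : ρ.IsHermitian) (H : Matrix ι ι ℂ) (i j : ι) :
    inner ℂ (hρ.eigenvectorBasis i) (Matrix.toEuclideanLin H (hρ.eigenvectorBasis j)) =
      inEigenbasis hρ H i j := by
  rw [inEigenbasis, Unitary.conjStarAlgAut_star_apply, Matrix.mul_assoc, Matrix.mul_apply,
    PiLp.inner_apply]
  refine Finset.sum_congr rfl fun x _ => ?_
  simp [Matrix.toEuclideanLin, Matrix.toLpLin_apply, Matrix.mul_apply, Matrix.mulVec, dotProduct,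
    Matrix.IsHermitian.eigenvectorUnitary_apply, mul_comm]

lemma qfi_eq_sum (hρ : ρ.IsHermitian) (H : Matrix ι ι ℂ) :
    qfi ρ H = ∑ i, ∑ j, 2 * ((hρ.eigenvalues i - hρ.eigenvalues j) ^ 2 /
      (hρ.eigenvalues i + hρ.eigenvalues j) * ‖inEigenbasis hρ H i j‖ ^ 2) := by
  rw [qfi, dif_pos hρ]
  simp only [inner_eigenvectorBasis, Finset.mul_sum]

lemma fisherFunctional_eq_qfi_sub (hρ : ρ.PosSemidef) (H X : Matrix ι ι ℂ) :
    fisherFunctional ρ H X = qfi ρ H - ∑ i, ∑ j,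
      1 / 2 * (hρ.1.eigenvalues i + hρ.1.eigenvalues j) * ‖inEigenbasis hρ.1 X i j -
        ((2 * (hρ.1.eigenvalues i - hρ.1.eigenvalues j) /
          (hρ.1.eigenvalues i + hρ.1.eigenvalues j) : ℝ) : ℂ) * inEigenbasis hρ.1 H i j‖ ^ 2 := by
  rw [← fisherFunctional_inEigenbasis hρ.1, inEigenbasis_self, fisherFunctional_diagonal,
    qfi_eq_sum hρ.1]
  simp only [← Finset.sum_sub_distrib]
  exact Finset.sum_congr rfl fun i _ => Finset.sum_congr rfl fun j _ =>
    re_mul_star_eq_sub_sq (hρ.eigenvalues_nonneg i) (hρ.eigenvalues_nonneg j) _ _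

theorem isGreatest_qfi (hρ : ρ.PosSemidef) (H : Matrix ι ι ℂ) :
    IsGreatest (Set.range (fisherFunctional ρ H)) (qfi ρ H) := by
  refine ⟨⟨(inEigenbasis hρ.1).symm (Matrix.of fun i j =>
    ((2 * (hρ.1.eigenvalues i - hρ.1.eigenvalues j) /
      (hρ.1.eigenvalues i + hρ.1.eigenvalues j) : ℝ) : ℂ) * inEigenbasis hρ.1 H i j), ?_⟩, ?_⟩
  · simp [fisherFunctional_eq_qfi_sub hρ]
  · rintro _ ⟨X, rfl⟩
    rw [fisherFunctional_eq_qfi_sub hρ]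
    refine sub_le_self _ (Finset.sum_nonneg fun i _ => Finset.sum_nonneg fun j _ => ?_)
    have := add_nonneg (hρ.eigenvalues_nonneg i) (hρ.eigenvalues_nonneg j)
    positivity

lemma fisherFunctional_le_qfi (hρ : ρ.PosSemidef) (H X : Matrix ι ι ℂ) :
    fisherFunctional ρ H X ≤ qfi ρ H :=
  (isGreatest_qfi hρ H).2 ⟨X, rfl⟩

lemma qfi_nonneg (hρ : ρ.PosSemidef) (H : Matrix ι ι ℂ) : 0 ≤ qfi ρ H :=
  (isGreatest_qfi hρ H).2 ⟨0, by simp [fisherFunctional]⟩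

lemma qfi_smul {c : ℝ} (hc : 0 ≤ c) (hρ : ρ.PosSemidef) (H : Matrix ι ι ℂ) :
    qfi (c • ρ) H = c * qfi ρ H := by
  obtain ⟨X, hX⟩ := (isGreatest_qfi hρ H).1
  refine (isGreatest_qfi (hρ.smul hc) H).unique
    ⟨⟨X, by rw [fisherFunctional_smul, hX]⟩, ?_⟩
  rintro _ ⟨Y, rfl⟩
  rw [fisherFunctional_smul]
  exact mul_le_mul_of_nonneg_left (fisherFunctional_le_qfi hρ H Y) hc

lemma qfi_sum_le {α : Type*} (s : Finset α) {ρ : α → Matrix ι ι ℂ}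
    (hρ : ∀ n ∈ s, (ρ n).PosSemidef) (H : Matrix ι ι ℂ) :
    qfi (∑ n ∈ s, ρ n) H ≤ ∑ n ∈ s, qfi (ρ n) H := by
  obtain ⟨X, hX⟩ := (isGreatest_qfi (Matrix.posSemidef_sum s hρ) H).1
  rw [← hX, fisherFunctional_sum]
  exact Finset.sum_le_sum fun n hn => fisherFunctional_le_qfi (hρ n hn) H X

lemma sum_qfi_le_qfi_sum_conj {α : Type*} [Fintype α] {β : α → Type} [∀ n, Fintype (β n)]
    [∀ n, DecidableEq (β n)] {E : ∀ n, Matrix ι (β n) ℂ} (hE : ∀ n, (E n)ᴴ * E n = 1)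
    (hE' : Pairwise fun m n => (E m)ᴴ * E n = 0) {H : Matrix ι ι ℂ}
    {G : ∀ n, Matrix (β n) (β n) ℂ} (hH : ∀ n, Intertwines (E n) H (G n))
    {τ : ∀ n, Matrix (β n) (β n) ℂ} (hτ : ∀ n, (τ n).PosSemidef) :
    ∑ n, qfi (τ n) (G n) ≤ qfi (∑ n, E n * τ n * (E n)ᴴ) H := by
  choose X hX using fun n => (isGreatest_qfi (hτ n) (G n)).1
  calc ∑ n, qfi (τ n) (G n)
      = ∑ n, fisherFunctional (E n * τ n * (E n)ᴴ) H (∑ m, E m * X m * (E m)ᴴ) :=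
        Finset.sum_congr rfl fun n _ => by
          rw [fisherFunctional_conj (hE n) (hH n) (intertwines_sum_conj hE hE' X n), hX]
    _ ≤ qfi (∑ n, E n * τ n * (E n)ᴴ) H := by
        rw [← fisherFunctional_sum]
        exact fisherFunctional_le_qfi
          (Matrix.posSemidef_sum _ fun n _ => (hτ n).mul_mul_conjTranspose_same (E n)) _ _

lemma qfi_le_qfi_conj {κ : Type} [Fintype κ] [DecidableEq κ] {E : Matrix ι κ ℂ}
    (hE : Eᴴ * E = 1) {H : Matrix ι ι ℂ} {G τ : Matrix κ κ ℂ} (hH : Intertwines E H G)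
    (hτ : τ.PosSemidef) : qfi τ G ≤ qfi (E * τ * Eᴴ) H := by
  simpa using sum_qfi_le_qfi_sum_conj (α := Unit) (fun _ => hE)
    (fun _ _ h => (h rfl).elim) (fun _ => hH) (fun _ => hτ)

lemma qfi_eq_zero_iff_commute (hρ : ρ.PosSemidef) (H : Matrix ι ι ℂ) :
    qfi ρ H = 0 ↔ Commute ρ H := by
  have hterm : ∀ {l m : ℝ}, 0 ≤ l → 0 ≤ m → ∀ g : ℂ,
      2 * ((l - m) ^ 2 / (l + m) * ‖g‖ ^ 2) = 0 ↔ l * g = g * m := fun {l m} hl hm g => by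
    rw [mul_comm g, ← sub_eq_zero (a := (l : ℂ) * g), ← sub_mul]
    simp only [mul_eq_zero, div_eq_zero_iff, pow_eq_zero_iff two_ne_zero, norm_eq_zero,
      OfNat.ofNat_ne_zero, false_or, sub_eq_zero, Complex.ofReal_inj]
    refine or_congr_left (or_iff_left_of_imp fun h => ?_)
    linarith
  have hl := hρ.eigenvalues_nonneg
  have hnonneg : ∀ i j, 0 ≤ 2 * ((hρ.1.eigenvalues i - hρ.1.eigenvalues j) ^ 2 /
      (hρ.1.eigenvalues i + hρ.1.eigenvalues j) * ‖inEigenbasis hρ.1 H i j‖ ^ 2) := fun i j => by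
    have := add_nonneg (hl i) (hl j)
    positivity
  rw [commute_iff_eq, ← EquivLike.apply_eq_iff_eq (inEigenbasis hρ.1), map_mul, map_mul,
    inEigenbasis_self, qfi_eq_sum hρ.1, ← Matrix.ext_iff,
    Fintype.sum_eq_zero_iff_of_nonneg fun i => Finset.sum_nonneg fun j _ => hnonneg i j]
  simp only [funext_iff, Pi.zero_apply, Matrix.diagonal_mul, Matrix.mul_diagonal]
  refine forall_congr' fun i => ?_
  rw [Fintype.sum_eq_zero_iff_of_nonneg (hnonneg i)]
  simp only [funext_iff, Pi.zero_apply, hterm (hl _) (hl _)]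

lemma qfi_le_trace (hρ : ρ.PosSemidef) (H : Matrix ι ι ℂ) :
    qfi ρ H ≤ 2 * (ρ * (H * Hᴴ + Hᴴ * H)).trace.re := by
  have htrace : ∀ A : Matrix ι ι ℂ, 0 ≤ (ρ * (A * Aᴴ)).trace.re := fun A => by
    rw [← Matrix.mul_assoc, Matrix.trace_mul_cycle]
    exact (Complex.le_def.1 (hρ.conjTranspose_mul_mul_same A).trace_nonneg).1
  obtain ⟨X, hX⟩ := (isGreatest_qfi hρ H).1
  have h1 := htrace (X - (2 : ℝ) • H)
  have h2 := htrace (X + (2 : ℝ) • H)ᴴ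
  rw [Matrix.conjTranspose_conjTranspose] at h2
  rw [← hX, fisherFunctional_eq_sub hρ.1]
  linarith

lemma qfi_diagonal_le (hρ : ρ.PosSemidef) (η : ι → ℂ) {B : ℝ} (hB : ∀ x, ‖η x‖ ≤ B) :
    qfi ρ (Matrix.diagonal η) ≤ 4 * B ^ 2 * ρ.trace.re := by
  have hsq : Matrix.diagonal η * (Matrix.diagonal η)ᴴ + (Matrix.diagonal η)ᴴ * Matrix.diagonal η =
      Matrix.diagonal fun x => ((2 * ‖η x‖ ^ 2 : ℝ) : ℂ) := by
    rw [Matrix.diagonal_conjTranspose, Matrix.diagonal_mul_diagonal, Matrix.diagonal_mul_diagonal,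
      Matrix.diagonal_add]
    congr 1 with x
    simp [Complex.mul_conj', Complex.conj_mul', two_mul]
  calc qfi ρ (Matrix.diagonal η)
      ≤ 2 * ∑ x, 2 * ‖η x‖ ^ 2 * (ρ x x).re := by
        refine (qfi_le_trace hρ _).trans_eq ?_
        rw [hsq, Matrix.trace_mul_comm, re_trace_diagonal_mul]
    _ ≤ 2 * ∑ x, 2 * B ^ 2 * (ρ x x).re := by
        gcongr with x
        · exact (Complex.le_def.1 hρ.diag_nonneg).1
        · exact hB x
    _ = 4 * B ^ 2 * ρ.trace.re := by
        rw [← Finset.mul_sum, Matrix.trace, Complex.re_sum]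
        simp only [Matrix.diag_apply]
        ring

end FisherInformation

section Operations

variable {ι κ μ : Type} [Fintype ι] [Fintype κ]

/-- The linear map `ρ ↦ K ρ Kᴴ` with the single Kraus operator `K`. -/
noncomputable def conjMap {ι κ : Type*} [Fintype ι] (K : Matrix κ ι ℂ) :
    Matrix ι ι ℂ →ₗ[ℂ] Matrix κ κ ℂ :=
  mulRightLinearMap κ ℂ Kᴴ ∘ₗ mulLeftLinearMap ι ℂ K

@[simp]
lemma conjMap_apply {ι κ : Type*} [Fintype ι] (K : Matrix κ ι ℂ) (ρ : Matrix ι ι ℂ) :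
    conjMap K ρ = K * ρ * Kᴴ :=
  rfl

/-- The Kraus operator `K` creates no coherence: `K σ Kᴴ` is diagonal for diagonal `σ`. In contrast
to `IsIncoherentKraus`, the matrix `σ` need not be a state. -/
def PreservesDiag {ι κ : Type*} [Fintype ι] (K : Matrix κ ι ℂ) : Prop :=
  ∀ ⦃σ : Matrix ι ι ℂ⦄, σ.IsDiag → (K * σ * Kᴴ).IsDiag

lemma isDiag_sum {α ι : Type*} {s : Finset α} {A : α → Matrix ι ι ℂ}
    (hA : ∀ n ∈ s, (A n).IsDiag) : (∑ n ∈ s, A n).IsDiag := by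
  intro i j hij
  rw [Matrix.sum_apply]
  exact Finset.sum_eq_zero fun n hn => hA n hn hij

lemma PreservesDiag.mul {ι κ μ : Type*} [Fintype ι] [Fintype κ] {L : Matrix μ κ ℂ}
    {K : Matrix κ ι ℂ} (hL : PreservesDiag L) (hK : PreservesDiag K) :
    PreservesDiag (L * K) := fun σ hσ => by
  simpa only [Matrix.conjTranspose_mul, Matrix.mul_assoc] using hL (hK hσ)

lemma preservesDiag_of_single {ι κ : Type*} [Fintype ι] [DecidableEq ι] {K : Matrix κ ι ℂ}
    (hK : ∀ i : ι, (K * Matrix.single i i (1 : ℂ) * Kᴴ).IsDiag) : PreservesDiag K := by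
  intro σ hσ
  have hsum : σ = ∑ i, σ i i • Matrix.single i i 1 := by
    simp only [Matrix.smul_single, smul_eq_mul, mul_one]
    exact hσ.diagonal_diag.symm.trans (Matrix.sum_single_eq_diagonal _).symm
  rw [hsum, Matrix.mul_sum, Matrix.sum_mul]
  refine isDiag_sum fun i _ => ?_
  rw [Matrix.mul_smul, Matrix.smul_mul]
  exact (hK i).smul _

lemma isIncoherentState_single [DecidableEq ι] (i : ι) :
    IsIncoherentState (Matrix.single i i (1 : ℂ)) := by
  rw [← Matrix.diagonal_single]
  exact ⟨⟨Matrix.PosSemidef.diagonal (Pi.single_nonneg.2 zero_le_one), by simp⟩,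
    Matrix.isDiag_diagonal _⟩

lemma IsIncoherentKraus.preservesDiag [DecidableEq ι] {r : ℕ} {K : Fin r → Matrix κ ι ℂ}
    (hK : IsIncoherentKraus K) (n : Fin r) : PreservesDiag (K n) :=
  preservesDiag_of_single fun i => hK.2 n _ (isIncoherentState_single i)

lemma isIncoherentOperation_of_sum_conj [DecidableEq ι] {α : Type*} [Fintype α]
    {K : α → Matrix κ ι ℂ} (h1 : ∑ n, (K n)ᴴ * K n = 1) (hK : ∀ n, PreservesDiag (K n))
    {Φ : Matrix ι ι ℂ →ₗ[ℂ] Matrix κ κ ℂ} (hΦ : ∀ ρ, Φ ρ = ∑ n, K n * ρ * (K n)ᴴ) :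
    IsIncoherentOperation Φ := by
  let e := (Fintype.equivFin α).symm
  refine ⟨Fintype.card α, K ∘ e, ⟨?_, fun n σ hσ => hK _ hσ.2⟩, fun ρ => ?_⟩
  · exact (e.sum_comp fun n => (K n)ᴴ * K n).trans h1
  · exact (hΦ ρ).trans (e.sum_comp fun n => K n * ρ * (K n)ᴴ).symm

namespace IsIncoherentOperation

variable [DecidableEq ι] {Φ : Matrix ι ι ℂ →ₗ[ℂ] Matrix κ κ ℂ}

lemma isDiag (hΦ : IsIncoherentOperation Φ) {σ : Matrix ι ι ℂ} (hσ : σ.IsDiag) :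
    (Φ σ).IsDiag := by
  obtain ⟨r, K, hK, h⟩ := hΦ
  rw [h]
  exact isDiag_sum fun n _ => hK.preservesDiag n hσ

lemma posSemidef (hΦ : IsIncoherentOperation Φ) {σ : Matrix ι ι ℂ} (hσ : σ.PosSemidef) :
    (Φ σ).PosSemidef := by
  obtain ⟨r, K, -, h⟩ := hΦ
  rw [h]
  exact Matrix.posSemidef_sum _ fun n _ => hσ.mul_mul_conjTranspose_same _

lemma trace_eq (hΦ : IsIncoherentOperation Φ) (σ : Matrix ι ι ℂ) : (Φ σ).trace = σ.trace := by
  obtain ⟨r, K, hK, h⟩ := hΦ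
  rw [h, Matrix.trace_sum]
  simp only [Matrix.trace_mul_cycle (K _)]
  rw [← Matrix.trace_sum, ← Matrix.sum_mul, hK.1, Matrix.one_mul]

end IsIncoherentOperation

lemma isIncoherentOperation_sum_comp_conjMap [DecidableEq ι] [DecidableEq κ] [Fintype μ] {r : ℕ}
    {K : Fin r → Matrix κ ι ℂ} (hK : IsIncoherentKraus K)
    {Ψ : Fin r → Matrix κ κ ℂ →ₗ[ℂ] Matrix μ μ ℂ} (hΨ : ∀ n, IsIncoherentOperation (Ψ n)) :
    IsIncoherentOperation (∑ n, Ψ n ∘ₗ conjMap (K n)) := by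
  choose s L hL hΨL using hΨ
  refine isIncoherentOperation_of_sum_conj (α := Σ n, Fin (s n)) (K := fun x => L x.1 x.2 * K x.1)
    ?_ (fun x => ((hL x.1).preservesDiag x.2).mul (hK.preservesDiag x.1)) fun ρ => ?_
  · calc ∑ x : Σ n, Fin (s n), (L x.1 x.2 * K x.1)ᴴ * (L x.1 x.2 * K x.1)
        = ∑ n, (K n)ᴴ * (∑ i, (L n i)ᴴ * L n i) * K n := by
          simp only [Fintype.sum_sigma, Matrix.conjTranspose_mul, Matrix.mul_sum, Matrix.sum_mul,
            Matrix.mul_assoc]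
      _ = 1 := by simp only [(hL _).1, Matrix.mul_one, hK.1]
  · simp only [LinearMap.sum_apply, LinearMap.comp_apply, conjMap_apply, hΨL, Fintype.sum_sigma,
      Matrix.conjTranspose_mul, Matrix.mul_assoc]

lemma IsIncoherentOperation.comp [DecidableEq ι] [DecidableEq κ] [Fintype μ]
    {Ψ : Matrix κ κ ℂ →ₗ[ℂ] Matrix μ μ ℂ} {Φ : Matrix ι ι ℂ →ₗ[ℂ] Matrix κ κ ℂ}
    (hΨ : IsIncoherentOperation Ψ) (hΦ : IsIncoherentOperation Φ) :
    IsIncoherentOperation (Ψ ∘ₗ Φ) := by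
  obtain ⟨r, K, hK, h⟩ := hΦ
  convert isIncoherentOperation_sum_comp_conjMap hK fun _ => hΨ
  ext1 ρ
  simp only [LinearMap.comp_apply, h, map_sum, LinearMap.sum_apply, conjMap_apply]

end Operations

section Embedding

variable {α β γ : Type*} [DecidableEq β]

/-- The matrix sending the basis vector `a` to the basis vector `e a`. -/
def embed (e : α → β) : Matrix β α ℂ :=
  (1 : Matrix β β ℂ).submatrix id e

lemma conjTranspose_embed_mul_embed [Fintype β] (e : α → β) (f : γ → β) :
    (embed e)ᴴ * embed f = (1 : Matrix β β ℂ).submatrix e f := by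
  rw [embed, embed, Matrix.conjTranspose_submatrix, Matrix.conjTranspose_one]
  exact (Matrix.submatrix_mul_equiv _ _ e (Equiv.refl β) f).trans (by rw [Matrix.one_mul])

lemma conjTranspose_embed_mul_self [Fintype β] [DecidableEq α] {e : α → β}
    (he : Function.Injective e) : (embed e)ᴴ * embed e = 1 := by
  rw [conjTranspose_embed_mul_embed, Matrix.submatrix_one e he]

lemma conjTranspose_embed_mul_embed_eq_zero [Fintype β] {e : α → β} {f : γ → β}
    (h : ∀ a c, e a ≠ f c) : (embed e)ᴴ * embed f = 0 := by
  ext a c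
  rw [conjTranspose_embed_mul_embed, Matrix.submatrix_apply, Matrix.one_apply_ne (h a c),
    Matrix.zero_apply]

lemma intertwines_embed_diagonal [Fintype β] [Fintype α] [DecidableEq α] (e : α → β) (η : β → ℂ) :
    Intertwines (embed e) (Matrix.diagonal η) (Matrix.diagonal (η ∘ e)) where
  mul_eq := by
    ext b a
    by_cases h : b = e a <;> simp [embed, Matrix.one_apply, h]
  conjTranspose_mul_eq := by
    ext a b
    by_cases h : b = e a <;> simp [embed, Matrix.one_apply, h, Ne.symm]

lemma embed_mul_single_mul_conjTranspose [Fintype α] [DecidableEq α] (e : α → β) (a a' : α)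
    (c : ℂ) :
    embed e * Matrix.single a a' c * (embed e)ᴴ = Matrix.single (e a) (e a') c := by
  ext b b'
  rw [Matrix.mul_apply, Fintype.sum_eq_single a' fun x hx => by
    rw [Matrix.mul_single_apply_of_ne _ _ _ _ _ hx, zero_mul]]
  simp [embed, Matrix.single_apply, Matrix.one_apply, ← ite_and, and_comm, eq_comm]

lemma embed_comp [Fintype β] [DecidableEq γ] (f : β → γ) (e : α → β) :
    embed (f ∘ e) = embed f * embed e := by
  ext c a
  simp [embed, Matrix.mul_apply, Matrix.one_apply]

lemma preservesDiag_embed [Fintype α] (e : α → β) : PreservesDiag (embed e) := by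
  classical
  refine preservesDiag_of_single fun a => ?_
  rw [embed_mul_single_mul_conjTranspose, ← Matrix.diagonal_single]
  exact Matrix.isDiag_diagonal _

lemma isIncoherentOperation_conjMap_embed {ι κ : Type} [Fintype ι] [DecidableEq ι] [Fintype κ]
    [DecidableEq κ] {e : ι → κ} (he : Function.Injective e) :
    IsIncoherentOperation (conjMap (embed e)) :=
  isIncoherentOperation_of_sum_conj (α := Unit)
    (by simp only [Fintype.sum_unique, conjTranspose_embed_mul_self he])
    (fun _ => preservesDiag_embed e) fun ρ => by simp only [conjMap_apply, Fintype.sum_unique]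

end Embedding

section PartialTrace

variable {M : ℕ} {P Q : Fin M → Type} [∀ k, Fintype (P k)] [∀ k, DecidableEq (P k)]
  [∀ k, Fintype (Q k)] [∀ k, DecidableEq (Q k)]

/-- `reduceTo k` as a linear map. -/
noncomputable def reduceToₗ (k : Fin M) :
    Matrix (∀ l, P l) (∀ l, P l) ℂ →ₗ[ℂ] Matrix (P k) (P k) ℂ where
  toFun := reduceTo k
  map_add' ρ σ := by
    ext x y
    simp only [reduceTo, Matrix.of_apply, Matrix.add_apply, ← Finset.sum_add_distrib,
      ite_add_ite, add_zero]
  map_smul' c ρ := by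
    ext x y
    simp only [reduceTo, Matrix.of_apply, Matrix.smul_apply, Finset.smul_sum, smul_ite, smul_zero,
      RingHom.id_apply]

lemma reduceTo_sum {α : Type*} (s : Finset α) (k : Fin M)
    (ρ : α → Matrix (∀ l, P l) (∀ l, P l) ℂ) :
    reduceTo k (∑ n ∈ s, ρ n) = ∑ n ∈ s, reduceTo k (ρ n) :=
  map_sum (reduceToₗ k) ρ s

lemma reduceTo_smul (k : Fin M) (c : ℝ) (ρ : Matrix (∀ l, P l) (∀ l, P l) ℂ) :
    reduceTo k (c • ρ) = c • reduceTo k ρ :=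
  (reduceToₗ k).map_smul_of_tower c ρ

lemma trace_reduceTo (k : Fin M) (ρ : Matrix (∀ l, P l) (∀ l, P l) ℂ) :
    (reduceTo k ρ).trace = ρ.trace := by
  simp only [Matrix.trace, Matrix.diag_apply, reduceTo, Matrix.of_apply]
  rw [Finset.sum_comm]
  simp only [Finset.sum_ite_eq, Finset.mem_univ, if_true, Function.update_eq_self]

lemma isDiag_reduceTo (k : Fin M) {ρ : Matrix (∀ l, P l) (∀ l, P l) ℂ} (hρ : ρ.IsDiag) :
    (reduceTo k ρ).IsDiag := by
  intro x y hxy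
  rw [reduceTo, Matrix.of_apply]
  refine Finset.sum_eq_zero fun f _ => ite_eq_right_iff.2 fun hf => hρ fun hfy => hxy ?_
  rw [← hf, hfy, Function.update_self]

lemma reduceTo_eq_sum_submatrix (k : Fin M) (ρ : Matrix (∀ l, P l) (∀ l, P l) ℂ) :
    reduceTo k ρ = ∑ z, ρ.submatrix (fun x => (Equiv.piSplitAt k P).symm (x, z))
      (fun x => (Equiv.piSplitAt k P).symm (x, z)) := by
  have hupdate : ∀ x y z, Function.update ((Equiv.piSplitAt k P).symm (x, z)) k y =
      (Equiv.piSplitAt k P).symm (y, z) := fun x y z =>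
    Function.update_eq_iff.2 ⟨by simp, fun l hl => by simp [hl]⟩
  ext x y
  simp only [reduceTo, Matrix.of_apply, Matrix.sum_apply, Matrix.submatrix_apply]
  rw [← (Equiv.piSplitAt k P).symm.sum_comp, Fintype.sum_prod_type_right]
  refine Finset.sum_congr rfl fun z _ => ?_
  simp only [hupdate]
  simp

lemma posSemidef_reduceTo (k : Fin M) {ρ : Matrix (∀ l, P l) (∀ l, P l) ℂ} (hρ : ρ.PosSemidef) :
    (reduceTo k ρ).PosSemidef := by
  rw [reduceTo_eq_sum_submatrix]
  exact Matrix.posSemidef_sum _ fun z _ => hρ.submatrix _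

lemma reduceTo_single (k : Fin M) (f g : ∀ l, P l) (c : ℂ) :
    reduceTo k (Matrix.single f g c) =
      if ∀ l ≠ k, g l = f l then Matrix.single (f k) (g k) c else 0 := by
  ext x y
  rw [reduceTo, Matrix.of_apply, Fintype.sum_eq_single f fun f' hf' => by
    rw [Matrix.single_apply_of_row_ne hf'.symm, ite_self]]
  simp only [Matrix.single_apply, Function.eq_update_iff, true_and]
  split_ifs <;> simp_all

lemma reduceTo_embed_pi (k : Fin M) {e : ∀ l, P l → Q l} (he : ∀ l, Function.Injective (e l))
    (σ : Matrix (∀ l, P l) (∀ l, P l) ℂ) :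
    reduceTo k (embed (Pi.map e) * σ * (embed (Pi.map e))ᴴ) =
      embed (e k) * reduceTo k σ * (embed (e k))ᴴ := by
  suffices h : reduceToₗ k ∘ₗ conjMap (embed (Pi.map e)) = conjMap (embed (e k)) ∘ₗ reduceToₗ k from
    LinearMap.congr_fun h σ
  refine Matrix.ext_linearMap _ fun f g => LinearMap.ext fun c => ?_
  change reduceTo k (embed (Pi.map e) * Matrix.single f g c * (embed (Pi.map e))ᴴ) =
    embed (e k) * reduceTo k (Matrix.single f g c) * (embed (e k))ᴴ
  simp only [embed_mul_single_mul_conjTranspose, reduceTo_single, Pi.map_apply, (he _).eq_iff]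
  split_ifs
  · rw [embed_mul_single_mul_conjTranspose]
  · rw [Matrix.mul_zero, Matrix.zero_mul]

lemma reduceTo_embed_update (k : Fin M) (b : ∀ l, P l) (τ : Matrix (P k) (P k) ℂ) :
    reduceTo k (embed (Function.update b k) * τ * (embed (Function.update b k))ᴴ) = τ := by
  suffices h : reduceToₗ k ∘ₗ conjMap (embed (Function.update b k)) = LinearMap.id from
    LinearMap.congr_fun h τ
  refine Matrix.ext_linearMap _ fun x y => LinearMap.ext fun c => ?_
  change reduceTo k (embed (Function.update b k) * Matrix.single x y c *
    (embed (Function.update b k))ᴴ) = Matrix.single x y c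
  rw [embed_mul_single_mul_conjTranspose, reduceTo_single, if_pos fun l hl => by simp [hl],
    Function.update_self, Function.update_self]

end PartialTrace

section Hamiltonian

variable {N : ℕ} {d : Fin N → ℕ} {h : ∀ j, Matrix (Fin (d j)) (Fin (d j)) ℂ}

/-- The eigenvalue of the local Hamiltonian `∑ⱼ h⁽ʲ⁾` at a basis state of the particles. -/
noncomputable def energy (h : ∀ j, Matrix (Fin (d j)) (Fin (d j)) ℂ) (x : Particles d) : ℂ :=
  ∑ j, h j (x j) (x j)

lemma sum_onParticle_eq_diagonal (hd : ∀ j, (h j).IsDiag) :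
    ∑ j, onParticle j (h j) = Matrix.diagonal (energy h) := by
  ext x y
  rw [Matrix.sum_apply]
  rcases eq_or_ne x y with rfl | hxy
  · simp [onParticle, energy]
  · rw [Matrix.diagonal_apply_ne _ hxy]
    refine Finset.sum_eq_zero fun j _ => ite_eq_right_iff.2 fun hl => hd j fun hj => hxy ?_
    ext1 l
    rcases eq_or_ne l j with rfl | hlj
    · exact hj
    · exact hl l hlj

lemma localHamiltonian_eq_diagonal (hd : ∀ j, (h j).IsDiag) (a : ℕ) :
    localHamiltonian h a = Matrix.diagonal fun x : Partition d a => energy h x.1 := by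
  rw [localHamiltonian, sum_onParticle_eq_diagonal hd, ← Matrix.diagonal_one,
    Matrix.diagonal_kronecker_diagonal]
  simp only [mul_one]

lemma norm_energy_le (x : Particles d) : ‖energy h x‖ ≤ ∑ j, ∑ y, ‖h j y y‖ :=
  (norm_sum_le _ _).trans <| Finset.sum_le_sum fun j _ =>
    Finset.single_le_sum (f := fun y => ‖h j y y‖) (fun _ _ => norm_nonneg _)
      (Finset.mem_univ (x j))

lemma energy_update_sub (x : Particles d) (j : Fin N) (y : Fin (d j)) :
    energy h (Function.update x j y) - energy h x = h j y y - h j (x j) (x j) := by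
  rw [energy, energy, ← Finset.sum_sub_distrib, Fintype.sum_eq_single j fun l hl => by
    rw [Function.update_of_ne hl, sub_self], Function.update_self]

/-- Embedding of a partition into one with a larger ancilla, of dimension `∑ n, a n`, in which the
ancilla also records the label `n`. -/
def flagAncilla {r : ℕ} (d : Fin N → ℕ) (a : Fin r → ℕ) (n : Fin r) (x : Partition d (a n)) :
    Partition d (∑ n, a n) :=
  (x.1, finSigmaFinEquiv ⟨n, x.2⟩)

lemma flagAncilla_injective {r : ℕ} (d : Fin N → ℕ) (a : Fin r → ℕ) (n : Fin r) :
    Function.Injective (flagAncilla d a n) := fun x y hxy => by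
  simpa [flagAncilla, Prod.ext_iff] using hxy

lemma flagAncilla_ne {r : ℕ} (d : Fin N → ℕ) (a : Fin r → ℕ) {m n : Fin r} (hmn : m ≠ n)
    (x : Partition d (a m)) (y : Partition d (a n)) : flagAncilla d a m x ≠ flagAncilla d a n y :=
  fun hxy => hmn (congrArg Sigma.fst (finSigmaFinEquiv.injective (congrArg Prod.snd hxy)))

end Hamiltonian

section TotalFisherInformation

variable {M N : ℕ} {d : Fin M → Fin N → ℕ} {h : ∀ k j, Matrix (Fin (d k j)) (Fin (d k j)) ℂ}
  {a : Fin M → ℕ} {σ : Matrix (Output d a) (Output d a) ℂ}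

/-- The sum over all partitions of the quantum Fisher information available locally, which
`pureCoherence` optimizes over the output states `σ` of incoherent operations. -/
noncomputable def totalQFI (h : ∀ k j, Matrix (Fin (d k j)) (Fin (d k j)) ℂ) (a : Fin M → ℕ)
    (σ : Matrix (Output d a) (Output d a) ℂ) : ℝ :=
  ∑ k, qfi (reduceTo k σ) (localHamiltonian (h k) (a k))

lemma totalQFI_nonneg (hσ : σ.PosSemidef) : 0 ≤ totalQFI h a σ :=
  Finset.sum_nonneg fun k _ => qfi_nonneg (posSemidef_reduceTo k hσ) _

lemma totalQFI_smul {c : ℝ} (hc : 0 ≤ c) (hσ : σ.PosSemidef) :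
    totalQFI h a (c • σ) = c * totalQFI h a σ := by
  simp only [totalQFI, reduceTo_smul, qfi_smul hc (posSemidef_reduceTo _ hσ), Finset.mul_sum]

lemma totalQFI_le (hd : ∀ k j, (h k j).IsDiag) (hσ : σ.PosSemidef) :
    totalQFI h a σ ≤ ∑ k, 4 * (∑ j, ∑ y, ‖h k j y y‖) ^ 2 * σ.trace.re := by
  refine Finset.sum_le_sum fun k _ => ?_
  rw [localHamiltonian_eq_diagonal (hd k), ← trace_reduceTo k σ]
  exact qfi_diagonal_le (posSemidef_reduceTo k hσ) _ fun x => norm_energy_le x.1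

lemma totalQFI_eq_zero (hd : ∀ k j, (h k j).IsDiag) (hσ : σ.PosSemidef) (hσ' : σ.IsDiag) :
    totalQFI h a σ = 0 := by
  refine Finset.sum_eq_zero fun k _ => ?_
  rw [qfi_eq_zero_iff_commute (posSemidef_reduceTo k hσ), localHamiltonian_eq_diagonal (hd k),
    ← (isDiag_reduceTo k hσ').diagonal_diag]
  exact Matrix.commute_diagonal _ _

/-- Embedding of output systems which records the label `n` in the ancillas of every partition. -/
def flagOutput {r : ℕ} (d : Fin M → Fin N → ℕ) (a : Fin r → Fin M → ℕ) (n : Fin r) :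
    Output d (a n) → Output d fun k => ∑ n, a n k :=
  Pi.map fun k => flagAncilla (d k) (fun n => a n k) n

lemma flagOutput_injective {r : ℕ} (d : Fin M → Fin N → ℕ) (a : Fin r → Fin M → ℕ) (n : Fin r) :
    Function.Injective (flagOutput d a n) :=
  Function.Injective.piMap fun k => flagAncilla_injective (d k) _ n

lemma sum_totalQFI_le (hd : ∀ k j, (h k j).IsDiag) {r : ℕ} (a : Fin r → Fin M → ℕ)
    {σ : ∀ n, Matrix (Output d (a n)) (Output d (a n)) ℂ} (hσ : ∀ n, (σ n).PosSemidef) :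
    ∑ n, totalQFI h (a n) (σ n) ≤ totalQFI h (fun k => ∑ n, a n k)
      (∑ n, embed (flagOutput d a n) * σ n * (embed (flagOutput d a n))ᴴ) := by
  simp only [totalQFI]
  rw [Finset.sum_comm]
  refine Finset.sum_le_sum fun k _ => ?_
  simp only [reduceTo_sum, flagOutput,
    reduceTo_embed_pi k fun l => flagAncilla_injective (d l) _ _]
  refine sum_qfi_le_qfi_sum_conj (fun n => conjTranspose_embed_mul_self (flagAncilla_injective ..))
    (fun m n hmn => conjTranspose_embed_mul_embed_eq_zero (flagAncilla_ne _ _ hmn)) (fun n => ?_)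
    fun n => posSemidef_reduceTo k (hσ n)
  rw [localHamiltonian_eq_diagonal (hd k), localHamiltonian_eq_diagonal (hd k)]
  exact intertwines_embed_diagonal _ _

end TotalFisherInformation

lemma norm_ofReal_sqrt_sq {p : ℝ} (hp : 0 ≤ p) : ‖(√p : ℂ)‖ ^ 2 = p := by
  rw [Complex.norm_real, Real.norm_eq_abs, sq_abs, Real.sq_sqrt hp]

section PureState

variable {ι κ : Type}

lemma pureState_smul (z : ℂ) (ψ : ι → ℂ) : pureState (z • ψ) = ‖z‖ ^ 2 • pureState ψ := by
  ext i j
  simp only [pureState, Matrix.vecMulVec_apply, Pi.smul_apply, Pi.star_apply, Matrix.smul_apply,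
    smul_eq_mul, star_mul', Complex.real_smul, Complex.ofReal_pow, ← Complex.mul_conj',
    Complex.star_def]
  ring

lemma pureState_single [DecidableEq ι] (i : ι) (c : ℂ) :
    pureState (Pi.single i c) = Matrix.single i i (‖c‖ ^ 2 : ℂ) := by
  rw [← Complex.mul_conj']
  ext x y
  simp [pureState, Matrix.vecMulVec_apply, Pi.single_apply, Matrix.single_apply, ← ite_and,
    eq_comm, and_comm]

lemma posSemidef_pureState [Finite ι] (ψ : ι → ℂ) : (pureState ψ).PosSemidef :=
  Matrix.posSemidef_vecMulVec_self_star ψ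

variable [Fintype ι]

lemma pureState_mulVec (K : Matrix κ ι ℂ) (ψ : ι → ℂ) :
    pureState (K *ᵥ ψ) = K * pureState ψ * Kᴴ := by
  rw [pureState, pureState, Matrix.mul_vecMulVec, Matrix.vecMulVec_mul, Matrix.star_mulVec]

lemma trace_pureState (ψ : ι → ℂ) : (pureState ψ).trace = ((∑ i, ‖ψ i‖ ^ 2 : ℝ) : ℂ) := by
  simp only [Matrix.trace, Matrix.diag_apply, pureState, Matrix.vecMulVec_apply, Pi.star_apply,
    Complex.star_def, Complex.mul_conj', Complex.ofReal_sum, Complex.ofReal_pow]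

open scoped MatrixOrder Matrix.Norms.L2Operator in
lemma exists_eq_sum_pureState {ρ : Matrix ι ι ℂ} (hρ : ρ.PosSemidef) :
    ∃ v : ι → ι → ℂ, ρ = ∑ i, pureState (v i) := by
  classical
  obtain ⟨B, rfl⟩ := CStarAlgebra.nonneg_iff_eq_star_mul_self.mp hρ.nonneg
  refine ⟨fun i => star (B i), ?_⟩
  ext x y
  simp [Matrix.mul_apply, Matrix.sum_apply, pureState, Matrix.vecMulVec_apply,
    Matrix.star_eq_conjTranspose]

lemma exists_isUnitVector_smul_eq [Nonempty ι] (v : ι → ℂ) :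
    ∃ ψ, IsUnitVector ψ ∧ v = (√(∑ i, ‖v i‖ ^ 2) : ℂ) • ψ := by
  classical
  set p := ∑ i, ‖v i‖ ^ 2 with hp
  have hp0 : 0 ≤ p := by positivity
  rcases eq_or_ne p 0 with h0 | h0
  · have hv : v = 0 := funext fun i => by
      simpa using (Finset.sum_eq_zero_iff_of_nonneg fun i _ => sq_nonneg ‖v i‖).1 h0 i
    refine ⟨Pi.single (Classical.arbitrary ι) 1, ?_, by simp [h0, hv]⟩
    rw [IsUnitVector, Fintype.sum_eq_single (Classical.arbitrary ι) fun i hi => by simp [hi]]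
    simp
  · have hs : (√p : ℂ) ≠ 0 := by simpa using (Real.sqrt_ne_zero hp0).2 h0
    refine ⟨(√p : ℂ)⁻¹ • v, ?_, (smul_inv_smul₀ hs v).symm⟩
    simp only [IsUnitVector, Pi.smul_apply, norm_smul, mul_pow, ← Finset.mul_sum, norm_inv,
      Complex.norm_real, Real.norm_eq_abs, inv_pow, sq_abs, Real.sq_sqrt hp0, ← hp]
    exact inv_mul_cancel₀ h0

end PureState

section Encoding

variable {ι : Type} [Fintype ι]

/-- Embedding of a system into a partition: the basis state `i` becomes the particle configuration
`g i`. The ancilla stores `i`, which makes the embedding injective for every `g`; its level `0` is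
left unused. -/
noncomputable def encodePartition {N : ℕ} {d : Fin N → ℕ} (g : ι → Particles d) (i : ι) :
    Partition d (Fintype.card ι + 1) :=
  (g i, (Fintype.equivFin ι i).succ)

lemma encodePartition_injective {N : ℕ} {d : Fin N → ℕ} (g : ι → Particles d) :
    Function.Injective (encodePartition g) := fun i j hij => by
  simpa [encodePartition] using congrArg Prod.snd hij

variable {M N : ℕ} {d : Fin M → Fin N → ℕ} [∀ k j, NeZero (d k j)]

/-- Embedding of a system into an output system which encodes it in partition `k` and leaves the
other partitions in a fixed basis state. -/
noncomputable def encode (k : Fin M) (g : ι → Particles (d k)) :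
    ι → Output d fun _ => Fintype.card ι + 1 :=
  Function.update (0 : Output d fun _ => Fintype.card ι + 1) k ∘ encodePartition g

lemma encode_injective (k : Fin M) (g : ι → Particles (d k)) : Function.Injective (encode k g) :=
  (Function.update_injective _ k).comp (encodePartition_injective g)

lemma reduceTo_embed_encode (k : Fin M) (g : ι → Particles (d k)) (τ : Matrix ι ι ℂ) :
    reduceTo k (embed (encode k g) * τ * (embed (encode k g))ᴴ) =
      embed (encodePartition g) * τ * (embed (encodePartition g))ᴴ := by
  rw [encode, embed_comp]
  simp only [Matrix.conjTranspose_mul, ← Matrix.mul_assoc]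
  simpa only [← Matrix.mul_assoc] using
    reduceTo_embed_update k (0 : Output d fun _ => Fintype.card ι + 1)
      (embed (encodePartition g) * τ * (embed (encodePartition g))ᴴ)

end Encoding

lemma sum_csSup_le {α : Type*} [Fintype α] {S : α → Set ℝ} (hne : ∀ n, (S n).Nonempty)
    (hb : ∀ n, BddAbove (S n)) {c : ℝ} (hc : ∀ w : α → ℝ, (∀ n, w n ∈ S n) → ∑ n, w n ≤ c) :
    ∑ n, sSup (S n) ≤ c := by
  choose u _ hlim hu using fun n => exists_seq_tendsto_sSup (hne n) (hb n)
  exact le_of_tendsto' (tendsto_finsetSum _ fun n _ => hlim n) fun m => hc _ fun n => hu n m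

section PureCoherence

variable {M N : ℕ} {d : Fin M → Fin N → ℕ} {h : ∀ k j, Matrix (Fin (d k j)) (Fin (d k j)) ℂ}
  {ι κ : Type} [Fintype ι] [DecidableEq ι] [Fintype κ] [DecidableEq κ]

open scoped Pointwise in
lemma pureValues_smul (z : ℂ) (ψ : ι → ℂ) :
    pureValues h (z • ψ) = ‖z‖ ^ 2 • pureValues h ψ := by
  have hvalue : ∀ (a : Fin M → ℕ) (Φ : Matrix ι ι ℂ →ₗ[ℂ] Matrix (Output d a) (Output d a) ℂ),
      IsIncoherentOperation Φ →
        totalQFI h a (Φ (pureState (z • ψ))) = ‖z‖ ^ 2 * totalQFI h a (Φ (pureState ψ)) :=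
    fun a Φ hΦ => by
      rw [pureState_smul, LinearMap.map_smul_of_tower,
        totalQFI_smul (by positivity) (hΦ.posSemidef (posSemidef_pureState ψ))]
  ext v
  constructor
  · rintro ⟨a, Φ, hΦ, rfl⟩
    exact ⟨_, ⟨a, Φ, hΦ, rfl⟩, (hvalue a Φ hΦ).symm⟩
  · rintro ⟨_, ⟨a, Φ, hΦ, rfl⟩, rfl⟩
    exact ⟨a, Φ, hΦ, (hvalue a Φ hΦ).symm⟩

lemma pureCoherence_smul (z : ℂ) (ψ : ι → ℂ) :
    pureCoherence h (z • ψ) = ‖z‖ ^ 2 * pureCoherence h ψ := by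
  rw [pureCoherence, pureValues_smul, Real.sSup_smul_of_nonneg (by positivity), smul_eq_mul,
    pureCoherence]

lemma pureCoherence_nonneg (ψ : ι → ℂ) : 0 ≤ pureCoherence h ψ := by
  refine Real.sSup_nonneg ?_
  rintro _ ⟨a, Φ, hΦ, rfl⟩
  exact totalQFI_nonneg (hΦ.posSemidef (posSemidef_pureState ψ))

lemma bddAbove_pureValues (hd : ∀ k j, (h k j).IsDiag) (ψ : ι → ℂ) :
    BddAbove (pureValues h ψ) := by
  refine ⟨∑ k, 4 * (∑ j, ∑ y, ‖h k j y y‖) ^ 2 * (pureState ψ).trace.re, ?_⟩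
  rintro _ ⟨a, Φ, hΦ, rfl⟩
  rw [← hΦ.trace_eq]
  exact totalQFI_le hd (hΦ.posSemidef (posSemidef_pureState ψ))

lemma pureCoherence_eq_zero (hd : ∀ k j, (h k j).IsDiag) {ψ : ι → ℂ} (hψ : (pureState ψ).IsDiag) :
    pureCoherence h ψ = 0 := by
  refine le_antisymm (Real.sSup_nonpos ?_) (pureCoherence_nonneg ψ)
  rintro _ ⟨a, Φ, hΦ, rfl⟩
  exact (totalQFI_eq_zero hd (hΦ.posSemidef (posSemidef_pureState ψ)) (hΦ.isDiag hψ)).le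

variable [∀ k j, NeZero (d k j)]

lemma qfi_le_totalQFI_encode (hd : ∀ k j, (h k j).IsDiag) (k : Fin M) (g : ι → Particles (d k))
    {τ : Matrix ι ι ℂ} (hτ : τ.PosSemidef) :
    qfi τ (Matrix.diagonal fun i => energy (h k) (g i)) ≤
      totalQFI h (fun _ => Fintype.card ι + 1)
        (embed (encode k g) * τ * (embed (encode k g))ᴴ) := by
  have hnonneg : ∀ l, 0 ≤ qfi (reduceTo l (embed (encode k g) * τ * (embed (encode k g))ᴴ))
      (localHamiltonian (h l) (Fintype.card ι + 1)) := fun l =>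
    qfi_nonneg (posSemidef_reduceTo l (hτ.mul_mul_conjTranspose_same _)) _
  calc qfi τ (Matrix.diagonal fun i => energy (h k) (g i))
      ≤ qfi (reduceTo k (embed (encode k g) * τ * (embed (encode k g))ᴴ))
          (localHamiltonian (h k) (Fintype.card ι + 1)) := by
        rw [localHamiltonian_eq_diagonal (hd k), reduceTo_embed_encode]
        exact qfi_le_qfi_conj (conjTranspose_embed_mul_self (encodePartition_injective g))
          (intertwines_embed_diagonal _ _) hτ
    _ ≤ _ := Finset.single_le_sum (fun l _ => hnonneg l) (Finset.mem_univ k)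

lemma qfi_le_pureCoherence (hd : ∀ k j, (h k j).IsDiag) (k : Fin M) (g : ι → Particles (d k))
    (ψ : ι → ℂ) :
    qfi (pureState ψ) (Matrix.diagonal fun i => energy (h k) (g i)) ≤ pureCoherence h ψ :=
  (qfi_le_totalQFI_encode hd k g (posSemidef_pureState ψ)).trans <|
    le_csSup (bddAbove_pureValues hd ψ)
      ⟨_, _, isIncoherentOperation_conjMap_embed (encode_injective k g), rfl⟩

variable [Nonempty (Fin M)]

lemma nonempty_pureValues (ψ : ι → ℂ) : (pureValues h ψ).Nonempty :=
  ⟨_, _, _, isIncoherentOperation_conjMap_embed (encode_injective (Classical.arbitrary (Fin M)) 0),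
    rfl⟩

lemma isLUB_pureCoherence (hd : ∀ k j, (h k j).IsDiag) (ψ : ι → ℂ) :
    IsLUB (pureValues h ψ) (pureCoherence h ψ) :=
  isLUB_csSup (nonempty_pureValues ψ) (bddAbove_pureValues hd ψ)

-- Measure `K`, run an almost optimal operation for each outcome, and record the outcome in the
-- ancillas, which keeps the branches orthogonal within every partition.
lemma sum_pureCoherence_mulVec_le (hd : ∀ k j, (h k j).IsDiag) {r : ℕ}
    {K : Fin r → Matrix κ ι ℂ} (hK : IsIncoherentKraus K) (ψ : ι → ℂ) :
    ∑ n, pureCoherence h (K n *ᵥ ψ) ≤ pureCoherence h ψ := by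
  refine sum_csSup_le (fun n => nonempty_pureValues _) (fun n => bddAbove_pureValues hd _)
    fun w hw => ?_
  choose a Φ hΦ hw using hw
  have hop : IsIncoherentOperation
      (∑ n, (conjMap (embed (flagOutput d a n)) ∘ₗ Φ n) ∘ₗ conjMap (K n)) :=
    isIncoherentOperation_sum_comp_conjMap hK fun n =>
      (isIncoherentOperation_conjMap_embed (flagOutput_injective d a n)).comp (hΦ n)
  calc ∑ n, w n = ∑ n, totalQFI h (a n) (Φ n (pureState (K n *ᵥ ψ))) :=
        Finset.sum_congr rfl fun n _ => hw n
    _ ≤ _ := sum_totalQFI_le hd a fun n => (hΦ n).posSemidef (posSemidef_pureState _)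
    _ ≤ pureCoherence h ψ := by
        refine le_csSup (bddAbove_pureValues hd ψ) ⟨_, _, hop, ?_⟩
        simp only [LinearMap.sum_apply, LinearMap.comp_apply, conjMap_apply, pureState_mulVec,
          totalQFI]

end PureCoherence

section ConvexRoof

variable {ι κ : Type}

/-- The values of `f` on the decompositions `ρ = ∑ᵢ |vᵢ⟩⟨vᵢ|`. In contrast to `roofValues`, the
weights of a decomposition are absorbed into the unnormalized vectors `vᵢ`. -/
def decompositionValues (f : (ι → ℂ) → ℝ) (ρ : Matrix ι ι ℂ) : Set ℝ :=
  {c | ∃ (m : ℕ) (v : Fin m → ι → ℂ), ρ = ∑ i, pureState (v i) ∧ c = ∑ i, f (v i)}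

/-- The convex roof of a function `f` of unnormalized state vectors, used for `f` with
`f (z • ψ) = ‖z‖ ^ 2 * f ψ`. -/
noncomputable def convexRoof (f : (ι → ℂ) → ℝ) (ρ : Matrix ι ι ℂ) : ℝ :=
  sInf (decompositionValues f ρ)

lemma sum_mem_decompositionValues {α : Type*} [Fintype α] (f : (ι → ℂ) → ℝ) (v : α → ι → ℂ) :
    ∑ i, f (v i) ∈ decompositionValues f (∑ i, pureState (v i)) := by
  let e := (Fintype.equivFin α).symm
  exact ⟨Fintype.card α, v ∘ e, (e.sum_comp fun i => pureState (v i)).symm,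
    (e.sum_comp fun i => f (v i)).symm⟩

variable {f : (ι → ℂ) → ℝ} {g : (κ → ℂ) → ℝ} {ρ σ : Matrix ι ι ℂ}

lemma nonneg_of_mem_decompositionValues (hf : ∀ ψ, 0 ≤ f ψ) {c : ℝ}
    (hc : c ∈ decompositionValues f ρ) : 0 ≤ c := by
  obtain ⟨m, v, -, rfl⟩ := hc
  exact Finset.sum_nonneg fun i _ => hf (v i)

lemma bddBelow_decompositionValues (hf : ∀ ψ, 0 ≤ f ψ) : BddBelow (decompositionValues f ρ) :=
  ⟨0, fun _ => nonneg_of_mem_decompositionValues hf⟩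

lemma convexRoof_nonneg (hf : ∀ ψ, 0 ≤ f ψ) : 0 ≤ convexRoof f ρ :=
  Real.sInf_nonneg fun _ => nonneg_of_mem_decompositionValues hf

lemma convexRoof_sum_pureState_le {α : Type*} [Fintype α] (hf : ∀ ψ, 0 ≤ f ψ) (v : α → ι → ℂ) :
    convexRoof f (∑ i, pureState (v i)) ≤ ∑ i, f (v i) :=
  csInf_le (bddBelow_decompositionValues hf) (sum_mem_decompositionValues f v)

lemma convexRoof_zero (hf : ∀ ψ, 0 ≤ f ψ) : convexRoof f 0 = 0 :=
  le_antisymm (by simpa using convexRoof_sum_pureState_le hf (Fin.elim0 : Fin 0 → ι → ℂ))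
    (convexRoof_nonneg hf)

lemma nonempty_decompositionValues [Finite ι] (hρ : ρ.PosSemidef) :
    (decompositionValues f ρ).Nonempty := by
  cases nonempty_fintype ι
  obtain ⟨v, rfl⟩ := exists_eq_sum_pureState hρ
  exact ⟨_, sum_mem_decompositionValues f v⟩

lemma convexRoof_add_le [Finite ι] (hf : ∀ ψ, 0 ≤ f ψ) (hρ : ρ.PosSemidef)
    (hσ : σ.PosSemidef) :
    convexRoof f (ρ + σ) ≤ convexRoof f ρ + convexRoof f σ := by
  rw [convexRoof, convexRoof, convexRoof,
    ← csInf_add (nonempty_decompositionValues hρ) (bddBelow_decompositionValues hf)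
      (nonempty_decompositionValues hσ) (bddBelow_decompositionValues hf)]
  refine csInf_le_csInf (bddBelow_decompositionValues hf)
    ((nonempty_decompositionValues hρ).add (nonempty_decompositionValues hσ)) ?_
  rintro _ ⟨_, ⟨m, v, rfl, rfl⟩, _, ⟨n, u, rfl, rfl⟩, rfl⟩
  simpa only [Fintype.sum_sum_type, Sum.elim_inl, Sum.elim_inr] using
    sum_mem_decompositionValues f (Sum.elim v u)

lemma convexRoof_smul_le [Finite ι] (hf : ∀ ψ, 0 ≤ f ψ)
    (hsmul : ∀ (z : ℂ) ψ, f (z • ψ) = ‖z‖ ^ 2 * f ψ) {c : ℝ} (hc : 0 ≤ c) (hρ : ρ.PosSemidef) :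
    convexRoof f (c • ρ) ≤ c * convexRoof f ρ := by
  rw [convexRoof, convexRoof, ← smul_eq_mul, ← Real.sInf_smul_of_nonneg hc]
  refine csInf_le_csInf (bddBelow_decompositionValues hf)
    (nonempty_decompositionValues hρ).smul_set ?_
  rintro _ ⟨_, ⟨m, v, rfl, rfl⟩, rfl⟩
  simpa only [pureState_smul, hsmul, norm_ofReal_sqrt_sq hc, ← Finset.smul_sum, ← Finset.mul_sum,
    smul_eq_mul] using sum_mem_decompositionValues f fun i => (√c : ℂ) • v i

lemma convexRoof_sum_le [Finite ι] {α : Type*} (hf : ∀ ψ, 0 ≤ f ψ) (s : Finset α)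
    {ρ : α → Matrix ι ι ℂ} (hρ : ∀ n ∈ s, (ρ n).PosSemidef) :
    convexRoof f (∑ n ∈ s, ρ n) ≤ ∑ n ∈ s, convexRoof f (ρ n) :=
  Finset.le_sum_of_subadditive_on_pred (convexRoof f) Matrix.PosSemidef (convexRoof_zero hf).le
    (fun _ _ => convexRoof_add_le hf) (fun _ _ => Matrix.PosSemidef.add) ρ hρ

lemma sum_convexRoof_conj_le [Fintype ι] {α : Type*} [Fintype α] (hg : ∀ ψ, 0 ≤ g ψ)
    {K : α → Matrix κ ι ℂ} (hK : ∀ ψ, ∑ n, g (K n *ᵥ ψ) ≤ f ψ) (hρ : ρ.PosSemidef) :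
    ∑ n, convexRoof g (K n * ρ * (K n)ᴴ) ≤ convexRoof f ρ := by
  refine le_csInf (nonempty_decompositionValues hρ) ?_
  rintro _ ⟨m, v, rfl, rfl⟩
  calc ∑ n, convexRoof g (K n * (∑ i, pureState (v i)) * (K n)ᴴ)
      = ∑ n, convexRoof g (∑ i, pureState (K n *ᵥ v i)) := by
        simp only [Matrix.mul_sum, Matrix.sum_mul, pureState_mulVec]
    _ ≤ ∑ n, ∑ i, g (K n *ᵥ v i) :=
        Finset.sum_le_sum fun n _ => convexRoof_sum_pureState_le hg _
    _ = ∑ i, ∑ n, g (K n *ᵥ v i) := Finset.sum_comm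
    _ ≤ ∑ i, f (v i) := Finset.sum_le_sum fun i _ => hK (v i)

lemma qfi_le_convexRoof [Fintype ι] [DecidableEq ι] {H : Matrix ι ι ℂ}
    (hf : ∀ ψ, qfi (pureState ψ) H ≤ f ψ) (hρ : ρ.PosSemidef) : qfi ρ H ≤ convexRoof f ρ := by
  refine le_csInf (nonempty_decompositionValues hρ) ?_
  rintro _ ⟨m, v, rfl, rfl⟩
  exact (qfi_sum_le _ (fun i _ => posSemidef_pureState (v i)) H).trans
    (Finset.sum_le_sum fun i _ => hf (v i))

lemma convexRoof_eq_zero_of_isDiag [Finite ι] (hf : ∀ ψ, 0 ≤ f ψ)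
    (hdiag : ∀ ψ, (pureState ψ).IsDiag → f ψ = 0) (hρ : ρ.PosSemidef) (hρ' : ρ.IsDiag) :
    convexRoof f ρ = 0 := by
  classical
  cases nonempty_fintype ι
  have hpure : ∀ i, pureState (Pi.single i (√‖ρ i i‖ : ℂ)) = Matrix.single i i (ρ i i) :=
    fun i => by
      rw [pureState_single, ← Complex.ofReal_pow, norm_ofReal_sqrt_sq (norm_nonneg _),
        ← Complex.eq_coe_norm_of_nonneg hρ.diag_nonneg]
  have hsum : ρ = ∑ i, pureState (Pi.single i (√‖ρ i i‖ : ℂ)) := by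
    simp only [hpure, Matrix.sum_single_eq_diagonal (fun i => ρ i i)]
    exact hρ'.diagonal_diag.symm
  refine le_antisymm ?_ (convexRoof_nonneg hf)
  calc convexRoof f ρ = convexRoof f (∑ i, pureState (Pi.single i (√‖ρ i i‖ : ℂ))) := by
        rw [← hsum]
    _ ≤ ∑ i, f (Pi.single i (√‖ρ i i‖ : ℂ)) := convexRoof_sum_pureState_le hf _
    _ = 0 := Finset.sum_eq_zero fun i _ => hdiag _ <| by
        rw [hpure, ← Matrix.diagonal_single]
        exact Matrix.isDiag_diagonal _

end ConvexRoof

section DistributedCoherence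

variable {M N : ℕ} {d : Fin M → Fin N → ℕ} {h : ∀ k j, Matrix (Fin (d k j)) (Fin (d k j)) ℂ}
  {ι κ : Type} [Fintype ι] [DecidableEq ι] [Fintype κ] [DecidableEq κ] {ρ σ : Matrix ι ι ℂ}

lemma roofValues_eq_decompositionValues (hρ : ρ.trace = 1) :
    roofValues h ρ = decompositionValues (pureCoherence h) ρ := by
  refine Set.Subset.antisymm ?_ ?_
  · rintro _ ⟨m, p, ψ, hp, -, -, rfl, rfl⟩
    simpa only [pureState_smul, pureCoherence_smul, norm_ofReal_sqrt_sq (hp _)] using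
      sum_mem_decompositionValues (pureCoherence h) fun i => (√(p i) : ℂ) • ψ i
  · rintro _ ⟨m, v, rfl, rfl⟩
    have : Nonempty ι := by
      by_contra hι
      rw [not_nonempty_iff] at hι
      simp [Matrix.trace] at hρ
    have hp : ∀ i, 0 ≤ ∑ x, ‖v i x‖ ^ 2 := fun i => by positivity
    choose ψ hψ hv using fun i => exists_isUnitVector_smul_eq (v i)
    refine ⟨m, fun i => ∑ x, ‖v i x‖ ^ 2, ψ, hp, ?_, hψ, ?_, ?_⟩
    · simp only [Matrix.trace_sum, trace_pureState] at hρ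
      exact_mod_cast hρ
    · refine Finset.sum_congr rfl fun i _ => ?_
      conv_lhs => rw [hv i, pureState_smul, norm_ofReal_sqrt_sq (hp i)]
    · refine Finset.sum_congr rfl fun i _ => ?_
      conv_lhs => rw [hv i, pureCoherence_smul, norm_ofReal_sqrt_sq (hp i)]

lemma distributedQFICoherence_eq_convexRoof (hρ : ρ.trace = 1) :
    distributedQFICoherence h ι ρ = convexRoof (pureCoherence h) ρ := by
  rw [distributedQFICoherence, roofValues_eq_decompositionValues hρ, convexRoof]

lemma isGLB_distributedQFICoherence (hρ : IsDensity ρ) :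
    IsGLB (roofValues h ρ) (distributedQFICoherence h ι ρ) := by
  rw [distributedQFICoherence, roofValues_eq_decompositionValues hρ.2]
  exact isGLB_csInf (nonempty_decompositionValues hρ.1)
    (bddBelow_decompositionValues pureCoherence_nonneg)

lemma distributedQFICoherence_nonneg (hρ : IsDensity ρ) :
    0 ≤ distributedQFICoherence h ι ρ := by
  rw [distributedQFICoherence_eq_convexRoof hρ.2]
  exact convexRoof_nonneg pureCoherence_nonneg

lemma distributedQFICoherence_convex (hρ : IsDensity ρ) (hσ : IsDensity σ) {t : ℝ} (h0 : 0 ≤ t)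
    (h1 : t ≤ 1) :
    distributedQFICoherence h ι (t • ρ + (1 - t) • σ) ≤
      t * distributedQFICoherence h ι ρ + (1 - t) * distributedQFICoherence h ι σ := by
  have h1' : 0 ≤ 1 - t := sub_nonneg.2 h1
  have htrace : (t • ρ + (1 - t) • σ).trace = 1 := by
    rw [Matrix.trace_add, Matrix.trace_smul, Matrix.trace_smul, hρ.2, hσ.2, ← add_smul,
      add_sub_cancel, one_smul]
  simp only [distributedQFICoherence_eq_convexRoof, hρ.2, hσ.2, htrace]
  exact (convexRoof_add_le pureCoherence_nonneg (hρ.1.smul h0) (hσ.1.smul h1')).trans <|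
    add_le_add (convexRoof_smul_le pureCoherence_nonneg pureCoherence_smul h0 hρ.1)
      (convexRoof_smul_le pureCoherence_nonneg pureCoherence_smul h1' hσ.1)

lemma distributedQFICoherence_eq_zero (hd : ∀ k j, (h k j).IsDiag) (hρ : IsIncoherentState ρ) :
    distributedQFICoherence h ι ρ = 0 := by
  rw [distributedQFICoherence_eq_convexRoof hρ.1.2]
  exact convexRoof_eq_zero_of_isDiag pureCoherence_nonneg (fun _ => pureCoherence_eq_zero hd)
    hρ.1.1 hρ.2

variable [∀ k j, NeZero (d k j)]

lemma exists_energy_ne (hd : ∀ k j, (h k j).IsDiag)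
    (hne : ∃ k j, ∀ c : ℂ, h k j ≠ c • (1 : Matrix (Fin (d k j)) (Fin (d k j)) ℂ)) :
    ∃ (k : Fin M) (x y : Particles (d k)), energy (h k) x ≠ energy (h k) y := by
  obtain ⟨k, j, hne⟩ := hne
  by_contra! hconst
  refine hne (h k j 0 0) ?_
  have hdiag : ∀ y, h k j y y = h k j 0 0 := fun y => by
    have := energy_update_sub (h := h k) 0 j y
    rwa [hconst k _ 0, sub_self, eq_comm, sub_eq_zero] at this
  rw [← (hd k j).diagonal_diag, ← Matrix.diagonal_one, ← Matrix.diagonal_smul]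
  congr 1
  ext y
  simpa using hdiag y

lemma isDiag_of_distributedQFICoherence_eq_zero (hd : ∀ k j, (h k j).IsDiag)
    (hne : ∃ k j, ∀ c : ℂ, h k j ≠ c • (1 : Matrix (Fin (d k j)) (Fin (d k j)) ℂ))
    (hρ : IsDensity ρ) (hzero : distributedQFICoherence h ι ρ = 0) : ρ.IsDiag := by
  obtain ⟨k, x, y, hxy⟩ := exists_energy_ne hd hne
  have hcommute : ∀ g : ι → Particles (d k),
      Commute ρ (Matrix.diagonal fun i => energy (h k) (g i)) := fun g => by
    rw [← qfi_eq_zero_iff_commute hρ.1]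
    refine le_antisymm ?_ (qfi_nonneg hρ.1 _)
    rw [← hzero, distributedQFICoherence_eq_convexRoof hρ.2]
    exact qfi_le_convexRoof (qfi_le_pureCoherence hd k g) hρ.1
  intro i j hij
  have hentry := congrFun₂ (hcommute (Function.update (fun _ => x) j y)).eq i j
  rw [Matrix.mul_diagonal, Matrix.diagonal_mul, Function.update_self,
    Function.update_of_ne hij, mul_comm, ← sub_eq_zero, ← sub_mul] at hentry
  exact (mul_eq_zero.1 hentry).resolve_left (sub_ne_zero.2 hxy.symm)

variable [Nonempty (Fin M)]

lemma distributedQFICoherence_strongMonotone (hd : ∀ k j, (h k j).IsDiag) {r : ℕ}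
    {K : Fin r → Matrix κ ι ℂ} (hK : IsIncoherentKraus K) (hρ : IsDensity ρ) :
    ∑ n, (K n * ρ * (K n)ᴴ).trace.re * distributedQFICoherence h κ
      (((K n * ρ * (K n)ᴴ).trace.re)⁻¹ • (K n * ρ * (K n)ᴴ)) ≤ distributedQFICoherence h ι ρ := by
  rw [distributedQFICoherence_eq_convexRoof hρ.2]
  refine le_trans (Finset.sum_le_sum fun n _ => ?_)
    (sum_convexRoof_conj_le pureCoherence_nonneg (sum_pureCoherence_mulVec_le hd hK) hρ.1)
  have hpos := hρ.1.mul_mul_conjTranspose_same (K n)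
  have htrace := Complex.eq_re_of_ofReal_le hpos.trace_nonneg
  set τ := K n * ρ * (K n)ᴴ
  rcases eq_or_ne τ.trace.re 0 with hp | hp
  · rw [hp, zero_mul]
    exact convexRoof_nonneg pureCoherence_nonneg
  have hp0 : 0 ≤ τ.trace.re := (Complex.le_def.1 hpos.trace_nonneg).1
  have hunit : (τ.trace.re⁻¹ • τ).trace = 1 := by
    rw [Matrix.trace_smul, htrace, Complex.ofReal_re, Complex.real_smul, ← Complex.ofReal_mul,
      inv_mul_cancel₀ hp, Complex.ofReal_one]
  rw [distributedQFICoherence_eq_convexRoof hunit]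
  calc τ.trace.re * convexRoof (pureCoherence h) (τ.trace.re⁻¹ • τ)
      ≤ τ.trace.re * (τ.trace.re⁻¹ * convexRoof (pureCoherence h) τ) := by
        gcongr
        exact convexRoof_smul_le pureCoherence_nonneg pureCoherence_smul (inv_nonneg.2 hp0) hpos
    _ = convexRoof (pureCoherence h) τ := mul_inv_cancel_left₀ hp _

lemma distributedQFICoherence_monotone (hd : ∀ k j, (h k j).IsDiag)
    {Φ : Matrix ι ι ℂ →ₗ[ℂ] Matrix κ κ ℂ} (hΦ : IsIncoherentOperation Φ) (hρ : IsDensity ρ) :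
    distributedQFICoherence h κ (Φ ρ) ≤ distributedQFICoherence h ι ρ := by
  rw [distributedQFICoherence_eq_convexRoof ((hΦ.trace_eq ρ).trans hρ.2),
    distributedQFICoherence_eq_convexRoof hρ.2]
  obtain ⟨r, K, hK, hKΦ⟩ := hΦ
  calc convexRoof (pureCoherence h) (Φ ρ)
      ≤ ∑ n, convexRoof (pureCoherence h) (K n * ρ * (K n)ᴴ) := by
        rw [hKΦ]
        exact convexRoof_sum_le pureCoherence_nonneg _ fun n _ =>
          hρ.1.mul_mul_conjTranspose_same (K n)
    _ ≤ convexRoof (pureCoherence h) ρ :=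
        sum_convexRoof_conj_le pureCoherence_nonneg (sum_pureCoherence_mulVec_le hd hK) hρ.1

lemma isCoherenceMeasure_distributedQFICoherence (hd : ∀ k j, (h k j).IsDiag)
    (hne : ∃ k j, ∀ c : ℂ, h k j ≠ c • (1 : Matrix (Fin (d k j)) (Fin (d k j)) ℂ)) :
    IsCoherenceMeasure fun ι _ _ => distributedQFICoherence h ι where
  nonneg _ _ _ _ := distributedQFICoherence_nonneg
  faithful _ _ _ _ hρ := ⟨fun hzero => ⟨hρ, isDiag_of_distributedQFICoherence_eq_zero hd hne hρ
    hzero⟩, distributedQFICoherence_eq_zero hd⟩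
  monotone _ _ _ _ _ _ _ _ := distributedQFICoherence_monotone hd
  strongMonotone _ _ _ _ _ _ _ _ _ := distributedQFICoherence_strongMonotone hd
  convex _ _ _ _ _ _ hρ hσ := distributedQFICoherence_convex hρ hσ

end DistributedCoherence

lemma neZero_of_forall_ne_smul_one {n : ℕ} {A : Matrix (Fin n) (Fin n) ℂ}
    (hA : ∀ c : ℂ, A ≠ c • 1) : NeZero n :=
  ⟨by rintro rfl; exact hA 0 (Subsingleton.elim _ _)⟩

end CoherenceQFI

open CoherenceQFI in
theorem theorem1_general {M N : ℕ} {d : Fin M → Fin N → ℕ} [∀ k j, NeZero (d k j)]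
    (h : ∀ k j, Matrix (Fin (d k j)) (Fin (d k j)) ℂ) (h_basis : ∀ k j, (h k j).IsDiag)
    (h_nontrivial : ∃ k j, ∀ c : ℂ, h k j ≠ c • (1 : Matrix (Fin (d k j)) (Fin (d k j)) ℂ)) :
    (∀ (ι : Type) [Fintype ι] [DecidableEq ι] (ψ : ι → ℂ),
      IsLUB (pureValues h ψ) (pureCoherence h ψ)) ∧
    (∀ (ι : Type) [Fintype ι] [DecidableEq ι] (ρ : Matrix ι ι ℂ), IsDensity ρ →
      IsGLB (roofValues h ρ) (distributedQFICoherence h ι ρ)) ∧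
    IsCoherenceMeasure (fun ι _ _ => distributedQFICoherence h ι) := by
  have : Nonempty (Fin M) := h_nontrivial.nonempty
  exact ⟨fun _ _ _ => isLUB_pureCoherence h_basis, fun _ _ _ _ => isGLB_distributedQFICoherence,
    isCoherenceMeasure_distributedQFICoherence h_basis h_nontrivial⟩

theorem theorem1 (M N : ℕ) (hM : 1 ≤ M) (hN : 1 ≤ N) (d : Fin M → Fin N → ℕ)
    (h : ∀ k j, Matrix (Fin (d k j)) (Fin (d k j)) ℂ)
    (h_herm : ∀ k j, (h k j).IsHermitian)
    (h_basis : ∀ k j, (h k j).IsDiag)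
    (h_nontrivial : ∀ k j, ∀ c : ℂ, h k j ≠ c • (1 : Matrix (Fin (d k j)) (Fin (d k j)) ℂ)) :
    (∀ (ι : Type) [Fintype ι] [DecidableEq ι] (ψ : ι → ℂ), CoherenceQFI.IsUnitVector ψ →
      IsLUB (CoherenceQFI.pureValues h ψ) (CoherenceQFI.pureCoherence h ψ)) ∧
    (∀ (ι : Type) [Fintype ι] [DecidableEq ι] (ρ : Matrix ι ι ℂ), CoherenceQFI.IsDensity ρ →
      IsGLB (CoherenceQFI.roofValues h ρ) (CoherenceQFI.distributedQFICoherence h ι ρ)) ∧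
    CoherenceQFI.IsCoherenceMeasure
      (fun ι _ _ => CoherenceQFI.distributedQFICoherence h ι) := by
  have := fun k j => CoherenceQFI.neZero_of_forall_ne_smul_one (h_nontrivial k j)
  have key := theorem1_general h h_basis ⟨⟨0, hM⟩, ⟨0, hN⟩, h_nontrivial _ _⟩
  exact ⟨fun ι _ _ ψ _ => key.1 ι ψ, key.2⟩
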